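/- Let $\ell\in(0,\infty]$, let $I=[-\ell/2,\ell/2]$ (with $I=\mathbb R$ if $\ell=\infty$), and let $\mathfrak F=\bigoplus_{n\ge 0}L^2_{\mathrm{sym}}(I^n)$ be the bosonic Fock space over $L^2(I)$, with vacuum $|\Omega\rangle$ and field operators $(\psi(x)\Phi)_n(x_1,\dots,x_n)=\sqrt{n+1}\,\Phi_{n+1}(x,x_1,\dots,x_n)$. Let $B\in M_D(\mathbb C)$ (it may depend on $\ell$), and let $Q,T:I\to M_D(\mathbb C)$ be matrix-valued functions with $Q$ integrable and $T$ locally integrable on $I$. For $a\le b$ let $$V_a^b=\mathcal P e^{\int_a^b Q(x)\,dx}=\sum_{n\ge0}\int_{a<x_1<\dots<x_n<b}Q(x_1)\cdots Q(x_n)\,dx_1\cdots dx_n ,$$ and for $x_1<\dots<x_j$ in $I$ put $$c_j(x_1,\dots,x_j)=\operatorname{Tr}\bigl(B\,V_{-\ell/2}^{x_1}T(x_1)V_{x_1}^{x_2}T(x_2)\cdots V_{x_{j-1}}^{x_j}T(x_j)V_{x_j}^{\ell/2}\bigr),\qquad c_0=\operatorname{Tr}\bigl(B\,V_{-\ell/2}^{\ell/2}\bigr).$$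 Suppose that all these coefficients are complex phases: there are real functions $\theta_j$ with $c_j(x_1,\dots,x_j)=e^{i\theta_j(x_1,\dots,x_j)}$ for all $j\ge0$ and all $x_1<\dots<x_j$ in $I$ (that is, $B,Q,T$ are the tensors of a phase cMPS). Then there is exactly one bounded operator $U_\theta$ on $\mathfrak F$ with $$U_\theta=\sum_{j=0}^\infty\int_{x_1<\dots<x_j}c_j(x_1,\dots,x_j)\,\psi^\dagger(x_1)\cdots\psi^\dagger(x_j)|\Omega\rangle\langle\Omega|\psi(x_j)\cdots\psi(x_1)\,dx_1\cdots dx_j .$$ It is diagonal, i.e. $(U_\theta\Phi)_j(x_1,\dots,x_j)=c_j(x_1,\dots,x_j)\,\Phi_j(x_1,\dots,x_j)$ for every $\Phi\in\mathfrak F$, every $j$ and almost all $x_1<\dots<x_j$ in $I$; it is unitary; and it is the continuous matrix product operator (cMPO) with tensors $B,Q,T$ and $L=R=0$: $$U_\theta=\operatorname{Tr}_D\Bigl(B\,\mathcal P e^{\int_I dx\,[Q(x)\otimes\mathrm{Id}+T(x)\otimes\mathrm{Ad}_x]}\Bigr)\bigl(|\Omega\rangle\langle\Omega|\bigr),\qquad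 \mathrm{Ad}_x[\cdot]=\psi^\dagger(x)[\cdot]\psi(x),$$ where the path-ordered exponential of $\mathfrak L_x=Q(x)\otimes\mathrm{Id}+T(x)\otimes\mathrm{Ad}_x$ is the series $\sum_n\int_{x_1<\dots<x_n}\mathfrak L_{x_1}\cdots\mathfrak L_{x_n}\,dx_1\cdots dx_n$. Both operator identities are understood as convergence (with absolutely convergent integrals) of the matrix elements $\langle\Phi|\cdot|\Psi\rangle$ between all vectors $\Phi,\Psi$ with finitely many particles and with wavefunctions that are restrictions to $I^n$ of symmetric, continuous, compactly supported functions on $\mathbb R^n$. -/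

import Mathlib

noncomputable section

namespace CMPO

open MeasureTheory
open scoped ENNReal

/-! ### The spatial interval and ordered configurations -/

/-- Half of the system size `ℓ ∈ [0, ∞]`, as an extended real number. -/
def half (ℓ : ℝ≥0∞) : EReal := ((ℓ / 2 : ℝ≥0∞) : EReal)

/-- The interval `I = [-ℓ/2, ℓ/2]` of length `ℓ` (the whole line if `ℓ = ∞`). -/
def box (ℓ : ℝ≥0∞) : Set ℝ := {y | -half ℓ ≤ (y : EReal) ∧ (y : EReal) ≤ half ℓ}

/-- The ordered `n`-point configurations `x₁ < x₂ < … < xₙ` in `J`: the domain of integration of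
the path-ordered measure. -/
def simplex (n : ℕ) (J : Set ℝ) : Set (Fin n → ℝ) := {x | StrictMono x ∧ ∀ i, x i ∈ J}

/-! ### Bosonic Fock space over `L²(I)` -/

/-- Lebesgue measure on `Iⁿ`. -/
def boxMeasure (ℓ : ℝ≥0∞) (n : ℕ) : Measure (Fin n → ℝ) :=
  Measure.pi fun _ => (volume : Measure ℝ).restrict (box ℓ)

instance (ℓ : ℝ≥0∞) (n : ℕ) : IsFiniteMeasureOnCompacts (boxMeasure ℓ n) :=
  inferInstanceAs (IsFiniteMeasureOnCompacts
    (Measure.pi fun _ : Fin n => (volume : Measure ℝ).restrict (box ℓ)))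

theorem measurePreserving_perm (ℓ : ℝ≥0∞) {n : ℕ} (σ : Equiv.Perm (Fin n)) :
    MeasurePreserving (fun x : Fin n → ℝ => x ∘ σ) (boxMeasure ℓ n) (boxMeasure ℓ n) := by
  have h := measurePreserving_piCongrLeft
    (fun _ : Fin n => (volume : Measure ℝ).restrict (box ℓ)) σ.symm
  convert h using 1
  · funext x i
    have := MeasurableEquiv.piCongrLeft_apply_apply (β := fun _ : Fin n => ℝ) σ.symm x (σ i)
    simpa using this.symm
  · rfl
  · rfl

/-- A permutation of the particles, acting on `L²(Iⁿ)`. -/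
def permute (ℓ : ℝ≥0∞) {n : ℕ} (σ : Equiv.Perm (Fin n)) :
    Lp ℂ 2 (boxMeasure ℓ n) →ₗᵢ[ℂ] Lp ℂ 2 (boxMeasure ℓ n) :=
  Lp.compMeasurePreservingₗᵢ ℂ (fun x : Fin n → ℝ => x ∘ σ) (measurePreserving_perm ℓ σ)

/-- The `n`-particle space: the symmetric functions in `L²(Iⁿ)`. -/
def Sector (ℓ : ℝ≥0∞) (n : ℕ) : Submodule ℂ (Lp ℂ 2 (boxMeasure ℓ n)) where
  carrier := {f | ∀ σ : Equiv.Perm (Fin n), permute ℓ σ f = f}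
  add_mem' := fun hf hg σ => by rw [map_add, hf σ, hg σ]
  zero_mem' := fun σ => map_zero _
  smul_mem' := fun c f hf σ => by rw [map_smul, hf σ]

instance (ℓ : ℝ≥0∞) (n : ℕ) : CompleteSpace (Sector ℓ n) := by
  have h : IsClosed (Sector ℓ n : Set (Lp ℂ 2 (boxMeasure ℓ n))) := by
    have : (Sector ℓ n : Set (Lp ℂ 2 (boxMeasure ℓ n))) =
        ⋂ σ : Equiv.Perm (Fin n), {f | permute ℓ σ f = f} := by
      ext f
      simp [Sector]
    rw [this]
    exact isClosed_iInter fun σ => isClosed_eq (permute ℓ σ).continuous continuous_id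
  exact h.completeSpace_coe

/-- The bosonic Fock space, the Hilbert direct sum of the `n`-particle spaces. -/
abbrev Fock (ℓ : ℝ≥0∞) : Type := lp (fun n => Sector ℓ n) 2

/-- The `n`-particle wavefunction of a Fock space vector. -/
def wavefunction {ℓ : ℝ≥0∞} (Φ : Fock ℓ) (n : ℕ) : (Fin n → ℝ) → ℂ :=
  ((Φ n : Sector ℓ n) : Lp ℂ 2 (boxMeasure ℓ n))

/-! ### Test vectors, on which the field operator `ψ(x)` acts pointwise -/

/-- Families of symmetric, continuous, compactly supported wavefunctions with finitely many
particles. -/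
def TestVector : Submodule ℂ ((n : ℕ) → (Fin n → ℝ) → ℂ) where
  carrier := {Φ | (∀ n, Continuous (Φ n)) ∧ (∀ n, HasCompactSupport (Φ n)) ∧
    (∀ n (σ : Equiv.Perm (Fin n)) x, Φ n (x ∘ σ) = Φ n x) ∧ {n | Φ n ≠ 0}.Finite}
  add_mem' := by
    rintro Φ Ψ ⟨h1, h2, h3, h4⟩ ⟨k1, k2, k3, k4⟩
    refine ⟨fun n => (h1 n).add (k1 n), fun n => (h2 n).add (k2 n), fun n σ x => ?_,
      (h4.union k4).subset fun n hn => ?_⟩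
    · simp [h3, k3]
    · by_contra h
      simp only [Set.mem_union, Set.mem_ofPred_eq, not_or, not_not] at h
      exact hn (by simp [h.1, h.2])
  zero_mem' := ⟨fun _ => continuous_const, fun _ => HasCompactSupport.zero, fun _ _ _ => rfl,
    by simp⟩
  smul_mem' := by
    rintro c Φ ⟨h1, h2, h3, h4⟩
    refine ⟨fun n => (h1 n).const_smul c, fun n => (h2 n).smul_left (f := fun _ => c),
      fun n σ x => ?_, h4.subset fun n hn => ?_⟩
    · simp [h3]
    · intro h
      exact hn (by simp [h])

/-- The vector of Fock space with the given wavefunctions (restricted to `Iⁿ`). -/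
def toFock (ℓ : ℝ≥0∞) (Φ : TestVector) : Fock ℓ :=
  have hL : ∀ n, MemLp (Φ.1 n) 2 (boxMeasure ℓ n) := fun n =>
    (Φ.2.1 n).memLp_of_hasCompactSupport (Φ.2.2.1 n)
  ⟨fun n => ⟨(hL n).toLp, fun σ => by
      refine (Lp.toLp_compMeasurePreserving (hL n) (measurePreserving_perm ℓ σ)).trans ?_
      congr 1
      funext x
      exact Φ.2.2.2.1 n σ x⟩,
    (memℓp_zero (Φ.2.2.2.2.subset fun n hn h => hn (by
      ext1
      simp only [h]
      exact MemLp.toLp_zero _))).of_exponent_ge zero_le⟩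

/-- The field operator `ψ(x)`: `(ψ(x)Φ)ₙ(x₁,…,xₙ) = √(n+1) Φₙ₊₁(x,x₁,…,xₙ)`. -/
def psi (x : ℝ) : TestVector →ₗ[ℂ] TestVector where
  toFun Φ := ⟨fun n y => (Real.sqrt (n + 1) : ℂ) * Φ.1 (n + 1) (Fin.cons x y), by
    have hcons : ∀ n : ℕ, Topology.IsClosedEmbedding
        (fun y : Fin n → ℝ => (Fin.cons x y : Fin (n + 1) → ℝ)) := fun n => by
      have hc : Continuous (fun y : Fin n → ℝ => (Fin.cons x y : Fin (n + 1) → ℝ)) := by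
        fun_prop
      have hp : Continuous (fun (z : Fin (n + 1) → ℝ) (i : Fin n) => z i.succ) := by fun_prop
      exact Function.LeftInverse.isClosedEmbedding (fun y => funext fun i => by simp) hp hc
    refine ⟨fun n => continuous_const.mul ((Φ.2.1 (n + 1)).comp (hcons n).continuous),
      fun n => ((Φ.2.2.1 (n + 1)).comp_isClosedEmbedding (hcons n)).mul_left,
      fun n σ y => ?_, ?_⟩
    · have h := Φ.2.2.2.1 (n + 1) (Equiv.Perm.decomposeFin.symm (0, σ)) (Fin.cons x y)
      show (Real.sqrt (n + 1) : ℂ) * Φ.1 (n + 1) (Fin.cons x (y ∘ σ)) =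
        (Real.sqrt (n + 1) : ℂ) * Φ.1 (n + 1) (Fin.cons x y)
      rw [← h]
      congr 1
      apply congrArg
      funext i
      refine Fin.cases ?_ (fun i => ?_) i <;> simp
    · refine (Φ.2.2.2.2.preimage (Nat.succ_injective.injOn)).subset fun n hn h => hn ?_
      funext y
      simp [h]⟩
  map_add' Φ Ψ := by
    ext n y
    simp [mul_add]
  map_smul' c Φ := by
    ext n y
    simp [mul_left_comm]

/-! ### Operator-valued distributions as forms, and the supermaps -/

/-- Sesquilinear forms `(Φ, Ψ) ↦ ⟨Φ|O|Ψ⟩` on test vectors. -/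
abbrev Form : Type := TestVector →ₗ⋆[ℂ] TestVector →ₗ[ℂ] ℂ

/-- The vacuum projector `|Ω⟩⟨Ω|`. -/
def vacuum : Form :=
  LinearMap.mk₂'ₛₗ (starRingEnd ℂ) (RingHom.id ℂ)
    (fun Φ Ψ => starRingEnd ℂ (Φ.1 0 Fin.elim0) * Ψ.1 0 Fin.elim0)
    (fun _ _ _ => by simp [add_mul]) (fun _ _ _ => by simp [mul_assoc])
    (fun _ _ _ => by simp [mul_add]) (fun _ _ _ => by simp [mul_left_comm])

/-- `l_x[·] = ψ†(x)[·]`, that is `⟨Φ|l_x[O]|Ψ⟩ = ⟨ψ(x)Φ|O|Ψ⟩`. -/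
def leftMap (x : ℝ) : Module.End ℂ Form where
  toFun F := F.comp (psi x)
  map_add' _ _ := rfl
  map_smul' _ _ := rfl

/-- `r_x[·] = [·]ψ(x)`, that is `⟨Φ|r_x[O]|Ψ⟩ = ⟨Φ|O|ψ(x)Ψ⟩`. -/
def rightMap (x : ℝ) : Module.End ℂ Form where
  toFun F := F.compl₂ (psi x)
  map_add' _ _ := rfl
  map_smul' _ _ := rfl

/-- `Ad_x[·] = ψ†(x)[·]ψ(x)`. -/
def adMap (x : ℝ) : Module.End ℂ Form := leftMap x * rightMap x

/-! ### The continuous matrix product operator -/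

variable {D : ℕ}

/-- The generator `Q(x) ⊗ Id + L(x) ⊗ l_x + R(x) ⊗ r_x + T(x) ⊗ Ad_x`, a matrix of supermaps. -/
def generator (Q L R T : ℝ → Matrix (Fin D) (Fin D) ℂ) (x : ℝ) :
    Matrix (Fin D) (Fin D) (Module.End ℂ Form) :=
  (Q x).map (fun q => q • (1 : Module.End ℂ Form)) + (L x).map (fun c => c • leftMap x) +
    (R x).map (fun c => c • rightMap x) + (T x).map (fun t => t • adMap x)

/-- The integrand `⟨Φ| Tr_D(B 𝔏_{x₁} ⋯ 𝔏_{xₙ})(|Ω⟩⟨Ω|) |Ψ⟩` of the `n`-th order of the path-ordered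
exponential. -/
def dysonIntegrand (B : Matrix (Fin D) (Fin D) ℂ) (Q L R T : ℝ → Matrix (Fin D) (Fin D) ℂ)
    (n : ℕ) (Φ Ψ : TestVector) (x : Fin n → ℝ) : ℂ :=
  Matrix.trace (B.map (algebraMap ℂ (Module.End ℂ Form)) *
    (List.ofFn fun i => generator Q L R T (x i)).prod) vacuum Φ Ψ

/-- `O = Tr_D(B 𝒫exp ∫_I 𝔏_x dx)(|Ω⟩⟨Ω|)`: the path-ordered (Dyson) series converges to `O` in the
sense of matrix elements between test vectors. -/
def IsCMPO (ℓ : ℝ≥0∞) (B : Matrix (Fin D) (Fin D) ℂ) (Q L R T : ℝ → Matrix (Fin D) (Fin D) ℂ)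
    (O : Fock ℓ →L[ℂ] Fock ℓ) : Prop :=
  ∀ Φ Ψ : TestVector,
    (∀ n, IntegrableOn (dysonIntegrand B Q L R T n Φ Ψ) (simplex n (box ℓ))) ∧
    HasSum (fun n => ∫ x in simplex n (box ℓ), dysonIntegrand B Q L R T n Φ Ψ x)
      (inner ℂ (toFock ℓ Φ) (O (toFock ℓ Ψ)))

/-! ### Matrix-product coefficients and the diagonal operator -/

/-- The free propagator `V_a^b = 𝒫exp ∫_a^b Q(x) dx`, as its path-ordered (Dyson) series. -/
def propagator (Q : ℝ → Matrix (Fin D) (Fin D) ℂ) (a b : EReal) : Matrix (Fin D) (Fin D) ℂ :=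
  Matrix.of fun r c => ∑' n : ℕ, ∫ x in simplex n {y : ℝ | a < (y : EReal) ∧ (y : EReal) < b},
    (List.ofFn fun i => Q (x i)).prod r c

/-- The factors `V_-^1, V_1^2, …, V_{j-1}^j, V_j^+` determined by `x₁ < … < x_j`. -/
def link (ℓ : ℝ≥0∞) (Q : ℝ → Matrix (Fin D) (Fin D) ℂ) {j : ℕ} (x : Fin j → ℝ)
    (i : Fin (j + 1)) : Matrix (Fin D) (Fin D) ℂ :=
  propagator Q
    ((Fin.cons (-half ℓ) (fun k => (x k : EReal)) : Fin (j + 1) → EReal) i)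
    ((Fin.snoc (fun k => (x k : EReal)) (half ℓ) : Fin (j + 1) → EReal) i)

/-- The continuous matrix-product coefficient `Tr(B V_-^1 T₁ V_1^2 ⋯ V_{j-1}^j T_j V_j^+)`. -/
def coefficient (ℓ : ℝ≥0∞) (B : Matrix (Fin D) (Fin D) ℂ) (Q T : ℝ → Matrix (Fin D) (Fin D) ℂ)
    {j : ℕ} (x : Fin j → ℝ) : ℂ :=
  Matrix.trace (B * (List.ofFn fun i : Fin j => link ℓ Q x i.castSucc * T (x i)).prod *
    link ℓ Q x (Fin.last j))

/-- The coefficients of the cMPS with tensors `B, Q, L` are complex phases. -/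
def IsPhaseCMPS (ℓ : ℝ≥0∞) (B : Matrix (Fin D) (Fin D) ℂ)
    (Q L : ℝ → Matrix (Fin D) (Fin D) ℂ) : Prop :=
  ∃ θ : (j : ℕ) → (Fin j → ℝ) → ℝ, ∀ (j : ℕ), ∀ x ∈ simplex j (box ℓ),
    coefficient ℓ B Q L x = Complex.exp (Complex.I * (θ j x : ℂ))

/-- The integrand
`Tr(B V_-^1 T₁ ⋯ T_j V_j^+) ⟨Φ|ψ†(x₁)⋯ψ†(x_j)|Ω⟩⟨Ω|ψ(x_j)⋯ψ(x₁)|Ψ⟩`. -/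
def fockIntegrand (ℓ : ℝ≥0∞) (B : Matrix (Fin D) (Fin D) ℂ)
    (Q T : ℝ → Matrix (Fin D) (Fin D) ℂ) (j : ℕ) (Φ Ψ : TestVector) (x : Fin j → ℝ) : ℂ :=
  coefficient ℓ B Q T x * (List.ofFn fun i => adMap (x i)).prod vacuum Φ Ψ

/-- `O = ∑ⱼ ∫ Dʲx Tr(B V_-^1 T₁ ⋯ T_j V_j^+) ψ†(x₁)⋯ψ†(x_j)|Ω⟩⟨Ω|ψ(x_j)⋯ψ(x₁)`, in the sense of
matrix elements between test vectors. -/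
def IsFockSeries (ℓ : ℝ≥0∞) (B : Matrix (Fin D) (Fin D) ℂ)
    (Q T : ℝ → Matrix (Fin D) (Fin D) ℂ) (O : Fock ℓ →L[ℂ] Fock ℓ) : Prop :=
  ∀ Φ Ψ : TestVector,
    (∀ j, IntegrableOn (fockIntegrand ℓ B Q T j Φ Ψ) (simplex j (box ℓ))) ∧
    HasSum (fun j => ∫ x in simplex j (box ℓ), fockIntegrand ℓ B Q T j Φ Ψ x)
      (inner ℂ (toFock ℓ Φ) (O (toFock ℓ Ψ)))

end CMPO

end

noncomputable section
namespace CMPO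
open MeasureTheory
open scoped ENNReal

section
/-! ### Ordered configurations -/

/-! The operator multiplies each wavefunction, on ordered configurations, by `coefficient`. These
coefficients are a.e. measurable and of modulus one there, so `exists_isPhase` extends them to
symmetric phases. Multiplication by such phases is an isometry of Fock space, inverted by the
conjugate phases, hence unitary. Applying field operators repeatedly to two test vectors produces
`pairing`, i.e. j! conj(Φⱼ) Ψⱼ, and this j! is the number of orderings of j points; hence the series
over particle numbers (`inner_mulFockL`). Uniqueness holds because test vectors span a dense
subspace (`ext_inner_toFock`).

The cMPO identity is a resummation. `Ad_x` acts on `pairing` by freezing its first variable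
(`pairing_psi`), so the n-th order of the path-ordered exponential integrates the sum of all words
in Q and T, weighted by `pairing` at the positions of T (`generator_prod_vacuum`). Summed over n,
this gives `dyson`, which satisfies a Volterra equation in the left endpoint: E_F(a) = F₀ + ∫ (Q E_F
+ T E_{shift F}). The inhomogeneity involves only the shifted amplitude, which has one variable
fewer. Duhamel's formula therefore collects the powers of Q before the first T into a propagator,
and induction on the number of particles, finite for test vectors, does the rest (`dyson_eq_sum`).
Duhamel's formula follows from uniqueness of bounded Volterra solutions. Convergence rests
throughout on the factor 1/n! of ordered configurations (`integral_chain_prod_le`).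

Since T is only locally integrable, it is first cut off to a compact interval containing all
coordinates at which `pairing` is nonzero; `word_congr` shows that this changes nothing. -/

/-- The reals strictly between two extended reals. -/
def between (a b : EReal) : Set ℝ := {y : ℝ | a < (y : EReal) ∧ (y : EReal) < b}

/-- The ordered configurations strictly between two extended reals. -/
def chain (n : ℕ) (a b : EReal) : Set (Fin n → ℝ) := simplex n (between a b)

theorem measurableSet_between (a b : EReal) : MeasurableSet (between a b) :=
  (measurableSet_lt measurable_const measurable_coe_real_ereal).inter
    (measurableSet_lt measurable_coe_real_ereal measurable_const)

theorem measurableSet_box (ℓ : ℝ≥0∞) : MeasurableSet (box ℓ) :=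
  (measurableSet_le measurable_const measurable_coe_real_ereal).inter
    (measurableSet_le measurable_coe_real_ereal measurable_const)

theorem measurableSet_setOf_strictMono (n : ℕ) :
    MeasurableSet {x : Fin n → ℝ | StrictMono x} := by
  have : {x : Fin n → ℝ | StrictMono x} = ⋂ i, ⋂ j, {x | i < j → x i < x j} := by
    ext x
    simp [StrictMono]
  rw [this]
  refine MeasurableSet.iInter fun i => MeasurableSet.iInter fun j => ?_
  by_cases h : i < j
  · simpa [h] using measurableSet_lt (measurable_pi_apply i) (measurable_pi_apply j)
  · simp [h]

theorem measurableSet_simplex {n : ℕ} {J : Set ℝ} (hJ : MeasurableSet J) :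
    MeasurableSet (simplex n J) := by
  have : simplex n J = {x | StrictMono x} ∩ ⋂ i, {x | x i ∈ J} := by
    ext x
    simp [simplex]
  rw [this]
  exact (measurableSet_setOf_strictMono n).inter
    (MeasurableSet.iInter fun i => measurable_pi_apply i hJ)

theorem measurableSet_chain (n : ℕ) (a b : EReal) : MeasurableSet (chain n a b) :=
  measurableSet_simplex (measurableSet_between a b)

theorem strictMono_cons_iff {n : ℕ} {t : ℝ} {y : Fin n → ℝ} :
    StrictMono (Fin.cons t y : Fin (n + 1) → ℝ) ↔ StrictMono y ∧ ∀ i, t < y i := by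
  constructor
  · intro h
    refine ⟨fun i j hij => ?_, fun i => ?_⟩
    · simpa using h (Fin.succ_lt_succ_iff.2 hij)
    · simpa using h (Fin.succ_pos i)
  · rintro ⟨h1, h2⟩ i j hij
    induction j using Fin.cases with
    | zero => exact absurd hij (Fin.not_lt_zero i)
    | succ j =>
      induction i using Fin.cases with
      | zero => simpa using h2 j
      | succ i => simpa using h1 (Fin.succ_lt_succ_iff.1 hij)

/-- The recursion behind every induction on n: the first point becomes the new left endpoint, while
the right endpoint stays fixed. -/
theorem cons_mem_chain {n : ℕ} {a b : EReal} {t : ℝ} {y : Fin n → ℝ} :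
    (Fin.cons t y : Fin (n + 1) → ℝ) ∈ chain (n + 1) a b ↔
      t ∈ between a b ∧ y ∈ chain n t b := by
  simp only [chain, simplex, between, Set.mem_ofPred_eq, strictMono_cons_iff, Fin.forall_fin_succ,
    Fin.cons_zero, Fin.cons_succ, EReal.coe_lt_coe_iff]
  constructor
  · rintro ⟨⟨h1, h2⟩, h3, h4⟩
    exact ⟨h3, h1, fun i => ⟨h2 i, (h4 i).2⟩⟩
  · rintro ⟨h3, h1, h2⟩
    exact ⟨⟨h1, fun i => (h2 i).1⟩, h3, fun i =>
      ⟨h3.1.trans (EReal.coe_lt_coe_iff.2 (h2 i).1), (h2 i).2⟩⟩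

theorem chain_zero (a b : EReal) : chain 0 a b = Set.univ := by
  ext x
  simp [chain, simplex, Subsingleton.strictMono]

theorem volume_fin_zero : (volume : Measure (Fin 0 → ℝ)) = Measure.dirac Fin.elim0 := by
  rw [volume_pi, Measure.pi_of_empty _ Fin.elim0]

theorem integral_chain_zero {E : Type*} [NormedAddCommGroup E] [NormedSpace ℝ E]
    [CompleteSpace E] (a b : EReal) (f : (Fin 0 → ℝ) → E) :
    ∫ x in chain 0 a b, f x = f Fin.elim0 := by
  rw [chain_zero, Measure.restrict_univ, volume_fin_zero, integral_dirac]

/-- Splitting off the first coordinate preserves Lebesgue measure. -/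
theorem measurePreserving_cons (n : ℕ) :
    MeasurePreserving (fun z : ℝ × (Fin n → ℝ) => (Fin.cons z.1 z.2 : Fin (n + 1) → ℝ)) := by
  have h := (volume_preserving_piFinSuccAbove (fun _ : Fin (n + 1) => ℝ) 0).symm
  convert h using 1
  funext z
  simp [MeasurableEquiv.piFinSuccAbove, Fin.insertNthEquiv]

theorem measurableEmbedding_cons (n : ℕ) :
    MeasurableEmbedding (fun z : ℝ × (Fin n → ℝ) => (Fin.cons z.1 z.2 : Fin (n + 1) → ℝ)) := by
  have h := (MeasurableEquiv.piFinSuccAbove (fun _ : Fin (n + 1) => ℝ) 0).symm.measurableEmbedding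
  convert h using 1
  funext z
  simp [MeasurableEquiv.piFinSuccAbove, Fin.insertNthEquiv]

/-! ### Fubini's theorem over ordered configurations -/

section Fubini

variable {E : Type*} [NormedAddCommGroup E] {n : ℕ} {a b : EReal} {f : (Fin (n + 1) → ℝ) → E}

theorem indicator_chain_cons (f : (Fin (n + 1) → ℝ) → E) (t : ℝ) (y : Fin n → ℝ) :
    (chain (n + 1) a b).indicator f (Fin.cons t y) =
      (between a b).indicator
        (fun t => (chain n t b).indicator (fun y => f (Fin.cons t y)) y) t := by
  by_cases ht : t ∈ between a b <;> by_cases hy : y ∈ chain n t b <;>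
    simp [Set.indicator, cons_mem_chain, ht, hy]

theorem integrable_indicator_cons (hf : IntegrableOn f (chain (n + 1) a b)) :
    Integrable (fun z : ℝ × (Fin n → ℝ) =>
      (chain (n + 1) a b).indicator f (Fin.cons z.1 z.2)) (volume.prod volume) :=
  ((measurePreserving_cons n).integrable_comp_emb (measurableEmbedding_cons n)).2
    ((integrable_indicator_iff (measurableSet_chain _ _ _)).2 hf)

variable [NormedSpace ℝ E]

theorem integral_indicator_chain_cons (f : (Fin (n + 1) → ℝ) → E) (t : ℝ) :
    ∫ y, (chain (n + 1) a b).indicator f (Fin.cons t y) =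
      (between a b).indicator (fun t => ∫ y in chain n t b, f (Fin.cons t y)) t := by
  simp_rw [indicator_chain_cons]
  by_cases ht : t ∈ between a b
  · simp [ht, integral_indicator (measurableSet_chain n t b)]
  · simp [ht]

theorem integrableOn_integral_chain (hf : IntegrableOn f (chain (n + 1) a b)) :
    IntegrableOn (fun t : ℝ => ∫ y in chain n t b, f (Fin.cons t y)) (between a b) := by
  have h := (integrable_indicator_cons hf).integral_prod_left
  simp_rw [integral_indicator_chain_cons] at h
  exact (integrable_indicator_iff (measurableSet_between a b)).1 h

/-- Fubini's theorem for the path-ordered measure: integrate over the first point last. -/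
theorem integral_chain_succ (hf : IntegrableOn f (chain (n + 1) a b)) :
    ∫ x in chain (n + 1) a b, f x =
      ∫ t in between a b, ∫ y in chain n t b, f (Fin.cons t y) := by
  rw [← integral_indicator (measurableSet_chain _ _ _),
    ← (measurePreserving_cons n).integral_comp (measurableEmbedding_cons n)]
  have h := integral_prod _ (integrable_indicator_cons hf)
  rw [← Measure.volume_eq_prod] at h
  rw [h]
  simp_rw [integral_indicator_chain_cons]
  rw [integral_indicator (measurableSet_between a b)]

end Fubini

/-! ### Symmetric integrands -/

theorem ae_forall_eval {p : ℝ → Prop} (n : ℕ) (h : ∀ᵐ t : ℝ, p t) :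
    ∀ᵐ x : Fin n → ℝ, ∀ i, p (x i) := by
  rw [ae_all_iff]
  intro i
  exact Measure.tendsto_eval_ae_ae (μ := fun _ : Fin n => (volume : Measure ℝ)) h

/-- Coincidences of two coordinates lie in finitely many hyperplanes, which are null sets. -/
theorem ae_injective (n : ℕ) : ∀ᵐ x : Fin n → ℝ, Function.Injective x := by
  have h : ∀ i j : Fin n, i ≠ j → ∀ᵐ x : Fin n → ℝ, x i ≠ x j := by
    intro i j hij
    let φ : (Fin n → ℝ) →ₗ[ℝ] ℝ := LinearMap.proj (R := ℝ) (φ := fun _ => ℝ) i - LinearMap.proj (R := ℝ) (φ := fun _ => ℝ) j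
    have hφ : LinearMap.ker φ ≠ ⊤ := by
      intro ht
      have : φ (Pi.single i 1) = 0 := by
        rw [LinearMap.ker_eq_top.1 ht]
        rfl
      simp [φ, hij.symm] at this
    have := Measure.addHaar_submodule (volume : Measure (Fin n → ℝ)) _ hφ
    rw [ae_iff]
    convert this using 2
    ext x
    simp [φ, sub_eq_zero]
  have : ∀ᵐ x : Fin n → ℝ, ∀ i j, i ≠ j → x i ≠ x j := by
    simp only [ae_all_iff]
    exact h
  filter_upwards [this] with x hx i j hij
  by_contra hne
  exact hx i j hne hij

/-- A strictly increasing enumeration is determined by its range. Hence the n! orderings of a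
configuration are disjoint cases. -/
theorem perm_eq_of_strictMono {n : ℕ} {x : Fin n → ℝ} {σ τ : Equiv.Perm (Fin n)}
    (hσ : StrictMono (x ∘ σ)) (hτ : StrictMono (x ∘ τ)) : σ = τ := by
  have hx : Function.Injective x := by
    have := hσ.injective.comp σ.symm.injective
    simpa [Function.comp_assoc] using this
  have hr : Set.range (x ∘ σ) = Set.range (x ∘ τ) := by
    rw [σ.surjective.range_comp, τ.surjective.range_comp]
  have h := (StrictMono.range_inj hσ hτ).1 hr
  exact Equiv.ext fun i => hx (congrFun h i)

theorem strictMono_comp_sort {n : ℕ} {x : Fin n → ℝ} (hx : Function.Injective x) :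
    StrictMono (x ∘ Tuple.sort x) :=
  (Tuple.monotone_sort x).strictMono_of_injective (hx.comp (Tuple.sort x).injective)

theorem volume_measurePreserving_perm {n : ℕ} (σ : Equiv.Perm (Fin n)) :
    MeasurePreserving (fun x : Fin n → ℝ => x ∘ σ) := by
  -- Infinite length makes the box the whole line, so the invariance already proved for `boxMeasure`
  -- applies.
  have h : boxMeasure ⊤ n = volume := by
    have : box ⊤ = Set.univ := by
      ext y
      simp [box, half, ENNReal.top_div]
    simp [boxMeasure, this, volume_pi]
  simpa [h] using measurePreserving_perm ⊤ σ

theorem measurableEmbedding_perm {n : ℕ} (σ : Equiv.Perm (Fin n)) :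
    MeasurableEmbedding (fun x : Fin n → ℝ => x ∘ σ) := by
  convert (MeasurableEquiv.piCongrLeft (fun _ : Fin n => ℝ) σ.symm).measurableEmbedding using 1
  funext x i
  have := MeasurableEquiv.piCongrLeft_apply_apply (β := fun _ : Fin n => ℝ) σ.symm x (σ i)
  simpa using this.symm

section Symmetric

variable {E : Type*} [NormedAddCommGroup E] [NormedSpace ℝ E] {n : ℕ}

/-- The integral of a symmetric function is `n!` times its integral over ordered configurations. -/
theorem integral_eq_factorial_smul {g : (Fin n → ℝ) → E} (hg : Integrable g)
    (hs : ∀ (σ : Equiv.Perm (Fin n)) x, g (x ∘ σ) = g x) :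
    ∫ x, g x = n.factorial • ∫ x in simplex n Set.univ, g x := by
  have hS : simplex n Set.univ = {x | StrictMono x} := by simp [simplex]
  let S : Equiv.Perm (Fin n) → Set (Fin n → ℝ) := fun σ => {x | StrictMono (x ∘ σ)}
  have hSpre : ∀ σ, S σ = (fun x : Fin n → ℝ => x ∘ σ) ⁻¹' {x | StrictMono x} := fun σ => rfl
  have hSm : ∀ σ, MeasurableSet (S σ) := fun σ => by
    rw [hSpre]
    exact (measurableEmbedding_perm σ).measurable (measurableSet_setOf_strictMono n)
  -- Only configurations with coinciding points escape, since all others can be sorted.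
  have hcover : (⋃ σ, S σ : Set (Fin n → ℝ)) =ᵐ[volume] Set.univ := by
    rw [ae_eq_univ]
    refine measure_mono_null (fun x hx => ?_) (ae_iff.1 (ae_injective n))
    intro hi
    exact hx (Set.mem_iUnion.2 ⟨Tuple.sort x, strictMono_comp_sort hi⟩)
  have hterm : ∀ σ, ∫ x in S σ, g x = ∫ x in simplex n Set.univ, g x := by
    intro σ
    have h := (volume_measurePreserving_perm σ).setIntegral_preimage_emb
      (measurableEmbedding_perm σ) g {x | StrictMono x}
    simp only [hs] at h
    rw [hS, hSpre, h]
  calc ∫ x, g x = ∫ x in ⋃ σ, S σ, g x := by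
        rw [setIntegral_congr_set hcover, Measure.restrict_univ]
    _ = ∑ σ, ∫ x in S σ, g x := by
        refine integral_iUnion_fintype hSm ?_ fun σ => hg.integrableOn
        intro σ τ hστ
        exact Set.disjoint_left.2 fun x h1 h2 => hστ (perm_eq_of_strictMono h1 h2)
    _ = _ := by
        simp [hterm, Fintype.card_perm]

end Symmetric

/-- The product is symmetric, so ordered configurations carry exactly 1/n! of its integral over ℝⁿ.
This is the source of all convergence below, uniformly in the endpoints. -/
theorem integral_chain_prod_le {α : ℝ → ℝ} (hα : Integrable α) (h0 : ∀ t, 0 ≤ α t) (n : ℕ)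
    (a b : EReal) :
    ∫ x in chain n a b, ∏ i, α (x i) ≤ (∫ t, α t) ^ n / n.factorial := by
  have hint : Integrable (fun x : Fin n → ℝ => ∏ i, α (x i)) :=
    Integrable.fintype_prod (fun _ => hα)
  have hsub : chain n a b ⊆ simplex n Set.univ := fun x hx => ⟨hx.1, fun _ => trivial⟩
  refine (setIntegral_mono_set hint.integrableOn
    (Filter.Eventually.of_forall fun x => Finset.prod_nonneg fun i _ => h0 _)
    hsub.eventuallyLE).trans ?_
  have h := integral_eq_factorial_smul hint fun σ x => Equiv.prod_comp σ fun i => α (x i)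
  rw [integral_fintype_prod_volume_eq_pow] at h
  rw [le_div_iff₀ (by positivity)]
  simp only [Fintype.card_fin, nsmul_eq_mul] at h
  rw [h, mul_comm]

end

section
/-! ### Dyson series in a Banach algebra -/

/-- Families of functions of finitely many real variables. -/
abbrev Amplitudes : Type := (j : ℕ) → (Fin j → ℝ) → ℂ

/-- Freeze the first variable. -/
def shift (t : ℝ) (F : Amplitudes) : Amplitudes := fun j y => F (j + 1) (Fin.cons t y)

/-- The family which is `1` in degree zero and vanishes in positive degrees. -/
def unitAmplitude : Amplitudes := fun j _ => if j = 0 then 1 else 0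

theorem shift_zero (t : ℝ) : shift t 0 = 0 := rfl

/-- Measurable families bounded by a constant. -/
structure Admissible (F : Amplitudes) (C : ℝ) : Prop where
  measurable : ∀ j, StronglyMeasurable (F j)
  norm_le : ∀ j x, ‖F j x‖ ≤ C

theorem measurable_finCons (n : ℕ) :
    Measurable (fun z : ℝ × (Fin n → ℝ) => (Fin.cons z.1 z.2 : Fin (n + 1) → ℝ)) :=
  (measurePreserving_cons n).measurable

theorem measurable_finTail (n : ℕ) :
    Measurable (fun x : Fin (n + 1) → ℝ => (Fin.tail x : Fin n → ℝ)) :=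
  measurable_pi_lambda _ fun i => measurable_pi_apply i.succ

theorem Admissible.shift {F : Amplitudes} {C : ℝ} (hF : Admissible F C) (t : ℝ) :
    Admissible (shift t F) C where
  measurable j := (hF.measurable (j + 1)).comp_measurable
    ((measurable_finCons j).comp measurable_prodMk_left)
  norm_le j _ := hF.norm_le (j + 1) _

theorem Admissible.nonneg {F : Amplitudes} {C : ℝ} (hF : Admissible F C) : 0 ≤ C :=
  (norm_nonneg _).trans (hF.norm_le 0 Fin.elim0)

theorem admissible_unitAmplitude : Admissible unitAmplitude 1 where
  measurable j := by
    unfold unitAmplitude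
    exact stronglyMeasurable_const
  norm_le j x := by
    unfold unitAmplitude
    split_ifs <;> simp

variable {A : Type*} [NormedRing A] [NormedAlgebra ℂ A]

/-- The sum of all products of `n` factors `Q` or `T`, weighted by the value of `F` at the
positions of the factors `T`. -/
def word (Q T : ℝ → A) : (n : ℕ) → Amplitudes → (Fin n → ℝ) → A
  | 0, F, _ => F 0 Fin.elim0 • (1 : A)
  | n + 1, F, x => Q (x 0) * word Q T n F (Fin.tail x) +
      T (x 0) * word Q T n (shift (x 0) F) (Fin.tail x)

theorem word_cons (Q T : ℝ → A) (n : ℕ) (F : Amplitudes) (t : ℝ) (y : Fin n → ℝ) :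
    word Q T (n + 1) F (Fin.cons t y) =
      Q t * word Q T n F y + T t * word Q T n (shift t F) y := by
  simp [word]

theorem word_zero_right (Q T : ℝ → A) (n : ℕ) (x : Fin n → ℝ) : word Q T n 0 x = 0 := by
  induction n with
  | zero => simp [word]
  | succ n ih => simp [word, shift_zero, ih]

theorem word_unitAmplitude (Q : ℝ → A) (n : ℕ) (x : Fin n → ℝ) :
    word Q 0 n unitAmplitude x = (List.ofFn fun i => Q (x i)).prod := by
  induction n with
  | zero => simp [word, unitAmplitude]
  | succ n ih => simp [word, ih, List.ofFn_succ, Fin.tail]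

/-- A word with T placed outside `K` has weight zero, because freezing a variable there kills `F`.
This allows T to be truncated to `K`. -/
theorem word_congr {Q Q' T T' : ℝ → A} {n : ℕ} {F : Amplitudes} {x : Fin n → ℝ} {K : Set ℝ}
    (hF : ∀ j y, F j y ≠ 0 → ∀ i, y i ∈ K) (hQ : ∀ i, Q (x i) = Q' (x i))
    (hT : ∀ i, x i ∈ K → T (x i) = T' (x i)) : word Q T n F x = word Q' T' n F x := by
  induction n generalizing F with
  | zero => rfl
  | succ n ih =>
    have h1 : word Q T n F (Fin.tail x) = word Q' T' n F (Fin.tail x) :=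
      ih hF (fun i => hQ i.succ) (fun i => hT i.succ)
    simp only [word, h1, hQ 0]
    by_cases h0 : x 0 ∈ K
    · rw [hT 0 h0, ih (F := shift (x 0) F) (x := Fin.tail x) _ (fun i => hQ i.succ) (fun i => hT i.succ)]
      intro j y hy i
      simpa using hF (j + 1) _ hy i.succ
    · have : shift (x 0) F = 0 := by
        funext j y
        by_contra hne
        exact h0 (by simpa using hF (j + 1) _ hne 0)
      simp [this, word_zero_right]

/-- Expanding ∏ (‖Q‖ + ‖T‖) lists one product of norms for each of the 2ⁿ words. -/
theorem norm_word_le (Q T : ℝ → A) (n : ℕ) {F : Amplitudes} {C : ℝ} (hF : ∀ j x, ‖F j x‖ ≤ C)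
    (x : Fin n → ℝ) :
    ‖word Q T n F x‖ ≤ C * ‖(1 : A)‖ * ∏ i, (‖Q (x i)‖ + ‖T (x i)‖) := by
  induction n generalizing F with
  | zero =>
    simpa [word, norm_smul] using mul_le_mul_of_nonneg_right (hF 0 Fin.elim0) (norm_nonneg (1 : A))
  | succ n ih =>
    have h1 := ih hF (Fin.tail x)
    have h2 := ih (F := shift (x 0) F) (fun j y => hF (j + 1) _) (Fin.tail x)
    rw [word, Fin.prod_univ_succ]
    refine (norm_add_le _ _).trans ?_
    refine (add_le_add ((norm_mul_le _ _).trans (mul_le_mul_of_nonneg_left h1 (norm_nonneg _)))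
      ((norm_mul_le _ _).trans (mul_le_mul_of_nonneg_left h2 (norm_nonneg _)))).trans (le_of_eq ?_)
    simp only [Fin.tail]
    ring

/-- The parameter space `P` is needed for the induction: the amplitude `shift (x 0) F` depends on
the first point, so the step passes from `P` to `P × ℝ`. -/
theorem stronglyMeasurable_word {Q T : ℝ → A} (hQ : StronglyMeasurable Q)
    (hT : StronglyMeasurable T) (n : ℕ) {P : Type*} [MeasurableSpace P] {F : P → Amplitudes}
    (hF : ∀ j, StronglyMeasurable fun q : P × (Fin j → ℝ) => F q.1 j q.2) :
    StronglyMeasurable fun q : P × (Fin n → ℝ) => word Q T n (F q.1) q.2 := by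
  induction n generalizing P with
  | zero =>
    have h : StronglyMeasurable fun q : P × (Fin 0 → ℝ) => F q.1 0 Fin.elim0 :=
      (hF 0).comp_measurable (measurable_fst.prodMk measurable_const)
    exact h.smul_const (1 : A)
  | succ n ih =>
    have h0 : Measurable fun q : P × (Fin (n + 1) → ℝ) => q.2 0 :=
      (measurable_pi_apply 0).comp measurable_snd
    have ht : Measurable fun q : P × (Fin (n + 1) → ℝ) => (Fin.tail q.2 : Fin n → ℝ) :=
      (measurable_finTail n).comp measurable_snd
    have hF' : ∀ j, StronglyMeasurable fun q : (P × ℝ) × (Fin j → ℝ) =>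
        shift q.1.2 (F q.1.1) j q.2 := fun j =>
      (hF (j + 1)).comp_measurable ((measurable_fst.comp measurable_fst).prodMk
        ((measurable_finCons j).comp ((measurable_snd.comp measurable_fst).prodMk measurable_snd)))
    have h1 := (ih hF).comp_measurable (measurable_fst.prodMk ht)
    have h2 := (ih (F := fun q : P × ℝ => shift q.2 (F q.1)) hF').comp_measurable
      ((measurable_fst.prodMk h0).prodMk ht)
    exact ((hQ.comp_measurable h0).mul h1).add ((hT.comp_measurable h0).mul h2)

theorem Admissible.stronglyMeasurable_word {Q T : ℝ → A} (hQ : StronglyMeasurable Q)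
    (hT : StronglyMeasurable T) (n : ℕ) {F : Amplitudes} {C : ℝ} (hF : Admissible F C) :
    StronglyMeasurable (word Q T n F) :=
  (CMPO.stronglyMeasurable_word hQ hT n (P := Unit) (F := fun _ => F) fun j =>
    (hF.measurable j).comp_measurable measurable_snd).comp_measurable
      (measurable_const (a := ()) |>.prodMk measurable_id)

/-- A pair of strongly measurable, integrable functions with values in a Banach algebra. -/
structure Tensors (Q T : ℝ → A) : Prop where
  measQ : StronglyMeasurable Q
  measT : StronglyMeasurable T
  intQ : Integrable Q
  intT : Integrable T

/-! ### Integrability and factorial bounds for words -/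

namespace Tensors

variable {Q T : ℝ → A} (h : Tensors Q T)
include h

omit [NormedAlgebra ℂ A] in
theorem zero_right : Tensors Q 0 :=
  ⟨h.measQ, stronglyMeasurable_zero, h.intQ, integrable_zero _ _ _⟩

omit [NormedAlgebra ℂ A] in
theorem integrable_weight : Integrable fun t => ‖Q t‖ + ‖T t‖ := h.intQ.norm.add h.intT.norm

theorem integrable_word (n : ℕ) {F : Amplitudes} {C : ℝ} (hF : Admissible F C) :
    Integrable (word Q T n F) :=
  Integrable.mono' ((Integrable.fintype_prod fun _ => h.integrable_weight).const_mul
      (C * ‖(1 : A)‖))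
    (hF.stronglyMeasurable_word h.measQ h.measT n).aestronglyMeasurable
    (Filter.Eventually.of_forall (norm_word_le Q T n hF.norm_le))

theorem integral_norm_word_le (n : ℕ) {F : Amplitudes} {C : ℝ} (hF : Admissible F C)
    (a b : EReal) :
    ∫ x in chain n a b, ‖word Q T n F x‖ ≤
      C * ‖(1 : A)‖ * ((∫ t, (‖Q t‖ + ‖T t‖)) ^ n / n.factorial) := by
  calc ∫ x in chain n a b, ‖word Q T n F x‖
      ≤ ∫ x in chain n a b, C * ‖(1 : A)‖ * ∏ i, (‖Q (x i)‖ + ‖T (x i)‖) :=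
        integral_mono_of_nonneg (Filter.Eventually.of_forall fun _ => norm_nonneg _)
          ((Integrable.fintype_prod fun _ => h.integrable_weight).const_mul _).integrableOn
          (Filter.Eventually.of_forall (norm_word_le Q T n hF.norm_le))
    _ = C * ‖(1 : A)‖ * ∫ x in chain n a b, ∏ i, (‖Q (x i)‖ + ‖T (x i)‖) :=
        integral_const_mul _ _
    _ ≤ _ := mul_le_mul_of_nonneg_left
        (integral_chain_prod_le h.integrable_weight (fun t => by positivity) n a b)
        (mul_nonneg hF.nonneg (norm_nonneg _))

omit h in
theorem summable_bound (c w : ℝ) : Summable fun n : ℕ => c * (w ^ n / n.factorial) :=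
  (Real.summable_pow_div_factorial w).mul_left c

theorem norm_integral_word_le (n : ℕ) {F : Amplitudes} {C : ℝ} (hF : Admissible F C)
    (a b : EReal) :
    ‖∫ x in chain n a b, word Q T n F x‖ ≤
      C * ‖(1 : A)‖ * ((∫ t, (‖Q t‖ + ‖T t‖)) ^ n / n.factorial) :=
  (norm_integral_le_integral_norm _).trans (h.integral_norm_word_le n hF a b)

variable [CompleteSpace A]

theorem summable_integral_word {F : Amplitudes} {C : ℝ} (hF : Admissible F C) (a b : EReal) :
    Summable fun n => ∫ x in chain n a b, word Q T n F x :=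
  .of_norm_bounded (summable_bound _ _) fun n => h.norm_integral_word_le n hF a b

end Tensors

/-- The Dyson series with amplitude `F`. -/
def dyson (Q T : ℝ → A) (F : Amplitudes) (a b : EReal) : A :=
  ∑' n, ∫ x in chain n a b, word Q T n F x

/-- The path-ordered exponential of `Q`. -/
def evol (Q : ℝ → A) (a b : EReal) : A := dyson Q 0 unitAmplitude a b

theorem dyson_zero_right (Q T : ℝ → A) (a b : EReal) : dyson Q T 0 a b = 0 := by
  simp [dyson, word_zero_right]

/-! ### Bounds, measurability and integral equations of the Dyson series -/

namespace Tensors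

variable {Q T : ℝ → A} (h : Tensors Q T) [CompleteSpace A]
include h

theorem hasSum_dyson {F : Amplitudes} {C : ℝ} (hF : Admissible F C) (a b : EReal) :
    HasSum (fun n => ∫ x in chain n a b, word Q T n F x) (dyson Q T F a b) :=
  (h.summable_integral_word hF a b).hasSum

omit [CompleteSpace A] in
-- The constant is ‖1‖ times an exponential series. Its independence of `F` and of the endpoints is
-- what makes the Volterra arguments below apply.
theorem exists_norm_dyson_le :
    ∃ K : ℝ, 0 ≤ K ∧ ∀ (F : Amplitudes) (C : ℝ), Admissible F C → ∀ a b,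
      ‖dyson Q T F a b‖ ≤ C * K := by
  set w := ∫ t, (‖Q t‖ + ‖T t‖)
  have hw : 0 ≤ w := integral_nonneg fun t => by positivity
  refine ⟨‖(1 : A)‖ * ∑' n : ℕ, w ^ n / n.factorial,
    mul_nonneg (norm_nonneg _) (tsum_nonneg fun n => by positivity), fun F C hF a b => ?_⟩
  rw [← mul_assoc, ← tsum_mul_left]
  exact tsum_of_norm_bounded (summable_bound _ _).hasSum fun n => h.norm_integral_word_le n hF a b

omit [CompleteSpace A] in
theorem exists_norm_evol_le : ∃ K : ℝ, 0 ≤ K ∧ ∀ a b, ‖evol Q a b‖ ≤ K := by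
  obtain ⟨K, hK0, hK⟩ := h.zero_right.exists_norm_dyson_le
  exact ⟨K, hK0, fun a b => by simpa [evol] using hK _ 1 admissible_unitAmplitude a b⟩

theorem stronglyMeasurable_dyson {P : Type*} [MeasurableSpace P] {F : P → Amplitudes} {C : ℝ}
    (hF : ∀ j, StronglyMeasurable fun q : P × (Fin j → ℝ) => F q.1 j q.2)
    (hC : ∀ p j x, ‖F p j x‖ ≤ C) :
    StronglyMeasurable fun q : P × (EReal × EReal) => dyson Q T (F q.1) q.2.1 q.2.2 := by
  have hA : ∀ p, Admissible (F p) C := fun p =>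
    ⟨fun j => (hF j).comp_measurable measurable_prodMk_left, hC p⟩
  have hterm : ∀ n, StronglyMeasurable fun q : P × (EReal × EReal) =>
      ∫ x in chain n q.2.1 q.2.2, word Q T n (F q.1) x := by
    intro n
    -- The endpoints are variables as well, so the domain of integration must be measurable jointly
    -- with them.
    have hS : MeasurableSet {z : (P × (EReal × EReal)) × (Fin n → ℝ) |
        z.2 ∈ chain n z.1.2.1 z.1.2.2} := by
      have : {z : (P × (EReal × EReal)) × (Fin n → ℝ) | z.2 ∈ chain n z.1.2.1 z.1.2.2} =
          {z | StrictMono z.2} ∩ ⋂ i, ({z | z.1.2.1 < (z.2 i : EReal)} ∩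
            {z | (z.2 i : EReal) < z.1.2.2}) := by
        ext z
        simp [chain, simplex, between]
      rw [this]
      refine (measurable_snd (measurableSet_setOf_strictMono n)).inter
        (MeasurableSet.iInter fun i => ?_)
      have hi : Measurable fun z : (P × (EReal × EReal)) × (Fin n → ℝ) => (z.2 i : EReal) :=
        measurable_coe_real_ereal.comp ((measurable_pi_apply i).comp measurable_snd)
      exact (measurableSet_lt (by fun_prop) hi).inter (measurableSet_lt hi (by fun_prop))
    have hm : StronglyMeasurable fun z : (P × (EReal × EReal)) × (Fin n → ℝ) =>
        word Q T n (F z.1.1) z.2 :=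
      (stronglyMeasurable_word h.measQ h.measT n hF).comp_measurable
        ((measurable_fst.comp measurable_fst).prodMk measurable_snd)
    have hI := (hm.indicator hS).integral_prod_right' (ν := volume)
    convert hI using 2 with q
    rw [← integral_indicator (measurableSet_chain _ _ _)]
    rfl
  refine stronglyMeasurable_of_tendsto Filter.atTop
    (f := fun N q => ∑ n ∈ Finset.range N, ∫ x in chain n q.2.1 q.2.2, word Q T n (F q.1) x)
    (fun N => ?_) ?_
  · exact Finset.stronglyMeasurable_fun_sum _ fun n _ => hterm n
  · rw [tendsto_pi_nhds]
    exact fun q => (h.hasSum_dyson (hA q.1) q.2.1 q.2.2).tendsto_sum_nat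

theorem stronglyMeasurable_evol :
    StronglyMeasurable fun q : EReal × EReal => evol Q q.1 q.2 :=
  (h.zero_right.stronglyMeasurable_dyson (P := Unit) (F := fun _ => unitAmplitude) (C := 1)
    (fun j => (admissible_unitAmplitude.measurable j).comp_measurable measurable_snd)
    (fun _ => admissible_unitAmplitude.norm_le)).comp_measurable
      (measurable_const (a := ()) |>.prodMk measurable_id)

/-- The integral equation of the Dyson series. -/
theorem dyson_eq {F : Amplitudes} {C : ℝ} (hF : Admissible F C) (a b : EReal) :
    dyson Q T F a b = F 0 Fin.elim0 • (1 : A) +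
      ∫ t in between a b, (Q t * dyson Q T F t b + T t * dyson Q T (shift t F) t b) := by
  rw [dyson, (h.summable_integral_word hF a b).tsum_eq_zero_add, integral_chain_zero]
  congr 1
  let G : ℕ → ℝ → A := fun n t => ∫ y in chain n t b, word Q T (n + 1) F (Fin.cons t y)
  have hi : ∀ n, IntegrableOn (word Q T n F) (chain n a b) := fun n =>
    (h.integrable_word n hF).integrableOn
  have hG : ∀ n, IntegrableOn (G n) (between a b) := fun n => integrableOn_integral_chain (hi _)
  -- Justifies exchanging the sum over orders with the integral over the first point; the factorial
  -- bound is used with its index raised by one.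
  have hGs : Summable fun n => ∫ t in between a b, ‖G n t‖ := by
    refine Summable.of_nonneg_of_le (fun n => integral_nonneg fun _ => norm_nonneg _) (fun n => ?_)
      ((summable_nat_add_iff 1).2
        (summable_bound (C * ‖(1 : A)‖) (∫ t, (‖Q t‖ + ‖T t‖))))
    refine le_trans ?_ (h.integral_norm_word_le (n + 1) hF a b)
    rw [integral_chain_succ (hi (n + 1)).norm]
    exact integral_mono (hG n).norm (integrableOn_integral_chain (hi (n + 1)).norm)
      fun t => norm_integral_le_integral_norm _
  have hGt : ∀ n t, G n t = Q t * (∫ y in chain n t b, word Q T n F y) +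
      T t * ∫ y in chain n t b, word Q T n (shift t F) y := by
    intro n t
    have i1 := (h.integrable_word n hF).integrableOn (s := chain n t b)
    have i2 := (h.integrable_word n (hF.shift t)).integrableOn (s := chain n t b)
    simp only [G, word_cons]
    rw [integral_add (i1.const_mul _) (i2.const_mul _), integral_const_mul_of_integrable i1,
      integral_const_mul_of_integrable i2]
  have key := hasSum_integral_of_summable_integral_norm hG hGs
  have hsum : ∀ t, ∑' n, G n t = Q t * dyson Q T F t b + T t * dyson Q T (shift t F) t b := by
    intro t
    simp only [hGt]
    exact (((h.hasSum_dyson hF t b).mul_left _).add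
      ((h.hasSum_dyson (hF.shift t) t b).mul_left _)).tsum_eq
  simp only [hsum] at key
  rw [← key.tsum_eq]
  exact tsum_congr fun n => integral_chain_succ (hi (n + 1))

theorem evol_eq (a b : EReal) : evol Q a b = 1 + ∫ t in between a b, Q t * evol Q t b := by
  have := h.zero_right.dyson_eq admissible_unitAmplitude a b
  simpa [evol, unitAmplitude] using this

omit [CompleteSpace A] in
/-- A bounded solution of the homogeneous Volterra equation vanishes. -/
theorem volterra_unique {D : EReal → A} {C : ℝ} (b : EReal) (hC : ∀ a, ‖D a‖ ≤ C)
    (hD : ∀ a, D a = ∫ t in between a b, Q t * D t) (a : EReal) : D a = 0 := by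
  have hi : ∀ n a, IntegrableOn (fun x : Fin n → ℝ => ∏ i, ‖Q (x i)‖) (chain n a b) := fun n a =>
    (Integrable.fintype_prod fun _ => h.intQ.norm).integrableOn
  have hC0 : 0 ≤ C := (norm_nonneg _).trans (hC a)
  -- Iterating the equation n times. The right side then tends to zero by the factorial bound. Only
  -- the majorant has to be integrable, so no measurability of `D` is needed.
  have key : ∀ n a, ‖D a‖ ≤ C * ∫ x in chain n a b, ∏ i, ‖Q (x i)‖ := by
    intro n
    induction n with
    | zero => simpa [chain_zero, volume_fin_zero, measureReal_def] using hC
    | succ n ih =>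
      intro a
      rw [hD a, integral_chain_succ (hi (n + 1) a), ← integral_const_mul]
      refine norm_integral_le_of_norm_le
        ((integrableOn_integral_chain (hi (n + 1) a)).const_mul C)
        (Filter.Eventually.of_forall fun t => ?_)
      refine (norm_mul_le _ _).trans ((mul_le_mul_of_nonneg_left (ih t) (norm_nonneg _)).trans
        (le_of_eq ?_))
      simp only [Fin.prod_univ_succ, Fin.cons_zero, Fin.cons_succ, integral_const_mul]
      ring
  have hlim := (summable_bound C (∫ t, ‖Q t‖)).tendsto_atTop_zero
  have hle : ‖D a‖ ≤ 0 := ge_of_tendsto' hlim fun n => (key n a).trans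
    (mul_le_mul_of_nonneg_left (integral_chain_prod_le h.intQ.norm (fun _ => norm_nonneg _) n a b)
      hC0)
  exact norm_le_zero_iff.1 hle

end Tensors

end

section
variable {A : Type*} [NormedRing A] [NormedAlgebra ℂ A]

/-! ### Duhamel's formula and the link expansion -/

/-- The product `V_a^{x₁} T(x₁) V_{x₁}^{x₂} ⋯ T(xⱼ) V_{xⱼ}^b`. -/
def linked (Q T : ℝ → A) (b : EReal) : (j : ℕ) → EReal → (Fin j → ℝ) → A
  | 0, a, _ => evol Q a b
  | j + 1, a, x => evol Q a (x 0) * T (x 0) * linked Q T b j (x 0) (Fin.tail x)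

theorem linked_cons (Q T : ℝ → A) (a b : EReal) (j : ℕ) (t : ℝ) (y : Fin j → ℝ) :
    linked Q T b (j + 1) a (Fin.cons t y) = evol Q a t * T t * linked Q T b j t y := by
  simp [linked]

theorem linked_congr {Q T T' : ℝ → A} {j : ℕ} {x : Fin j → ℝ} (hT : ∀ i, T (x i) = T' (x i))
    (a b : EReal) : linked Q T b j a x = linked Q T' b j a x := by
  induction j generalizing a with
  | zero => rfl
  | succ j ih => rw [linked, linked, hT 0, ih (x := Fin.tail x) fun i => hT i.succ]

variable {Q T : ℝ → A} [CompleteSpace A]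

namespace Tensors

theorem stronglyMeasurable_linked (h : Tensors Q 0) (hT : StronglyMeasurable T) (b : EReal)
    (j : ℕ) : StronglyMeasurable fun q : EReal × (Fin j → ℝ) => linked Q T b j q.1 q.2 := by
  induction j with
  | zero => exact h.stronglyMeasurable_evol.comp_measurable (measurable_fst.prodMk measurable_const)
  | succ j ih =>
    have h0 : Measurable fun q : EReal × (Fin (j + 1) → ℝ) => q.2 0 :=
      (measurable_pi_apply 0).comp measurable_snd
    have h1 := measurable_coe_real_ereal.comp h0
    exact ((h.stronglyMeasurable_evol.comp_measurable (measurable_fst.prodMk h1)).mul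
      (hT.comp_measurable h0)).mul (ih.comp_measurable
        (h1.prodMk ((measurable_finTail j).comp measurable_snd)))

variable (h : Tensors Q T)
include h

/-- Fubini's theorem on the triangle `a < s < t < b`. -/
theorem integral_triangle {g : ℝ → A} (hgm : StronglyMeasurable g) (hg : Integrable g)
    (a b : EReal) :
    ∫ t in between a b, (∫ s in between a t, Q s * evol Q s t) * g t =
      ∫ s in between a b, Q s * ∫ t in between s b, evol Q s t * g t := by
  obtain ⟨K, hK0, hK⟩ := h.exists_norm_evol_le
  have hm : StronglyMeasurable fun z : ℝ × ℝ => evol Q (z.2 : EReal) (z.1 : EReal) :=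
    h.stronglyMeasurable_evol.comp_measurable
      ((measurable_coe_real_ereal.comp measurable_snd).prodMk
        (measurable_coe_real_ereal.comp measurable_fst))
  let f : ℝ × ℝ → A := fun z => Q z.2 * evol Q z.2 z.1 * g z.1
  have hfm : StronglyMeasurable f :=
    ((h.measQ.comp_measurable measurable_snd).mul hm).mul (hgm.comp_measurable measurable_fst)
  have hfi : Integrable f (volume.prod volume) := by
    refine Integrable.mono' ((hg.norm.mul_prod h.intQ.norm).const_mul K)
      hfm.aestronglyMeasurable (Filter.Eventually.of_forall fun z => ?_)
    calc ‖f z‖ ≤ ‖Q z.2‖ * ‖evol Q z.2 z.1‖ * ‖g z.1‖ :=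
          (norm_mul_le _ _).trans
            (mul_le_mul_of_nonneg_right (norm_mul_le _ _) (norm_nonneg _))
      _ ≤ ‖Q z.2‖ * K * ‖g z.1‖ := by gcongr; exact hK _ _
      _ = K * (‖g z.1‖ * ‖Q z.2‖) := by ring
  -- The triangle in coordinates (t, s). Its slices are `between a t` for fixed t and `between s b`
  -- for fixed s.
  let S : Set (ℝ × ℝ) := {z | z.1 ∈ between a b ∧ z.2 ∈ between a z.1}
  have hS : MeasurableSet S := by
    have : S = (fun z : ℝ × ℝ => z.1) ⁻¹' between a b ∩ ((fun z : ℝ × ℝ => z.2) ⁻¹' between a ⊤ ∩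
        {z | z.2 < z.1}) := by
      ext z
      simp [S, between]
    rw [this]
    exact (measurable_fst (measurableSet_between a b)).inter
      ((measurable_snd (measurableSet_between a ⊤)).inter
        (measurableSet_lt measurable_snd measurable_fst))
  have hsi : ∀ t : ℝ, Integrable fun s : ℝ => Q s * evol Q s t := fun t =>
    h.intQ.mul_bdd (c := K) ((h.stronglyMeasurable_evol.comp_measurable
      (measurable_coe_real_ereal.prodMk measurable_const)).aestronglyMeasurable)
      (Filter.Eventually.of_forall fun s => hK _ _)
  have hti : ∀ s : ℝ, Integrable fun t : ℝ => evol Q s t * g t := fun s =>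
    hg.bdd_mul (c := K) ((h.stronglyMeasurable_evol.comp_measurable
      (measurable_const.prodMk measurable_coe_real_ereal)).aestronglyMeasurable)
      (Filter.Eventually.of_forall fun t => hK _ _)
  have hswap := integral_integral_swap (f := fun t s => S.indicator f (t, s)) (hfi.indicator hS)
  have h1 : ∀ t : ℝ, ∫ s, S.indicator f (t, s) = (between a b).indicator
      (fun t => (∫ s in between a t, Q s * evol Q s t) * g t) t := by
    intro t
    by_cases ht : t ∈ between a b
    · rw [Set.indicator_of_mem ht, ← integral_mul_const_of_integrable (hsi t).integrableOn,
        ← integral_indicator (measurableSet_between a t)]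
      refine integral_congr_ae (Filter.Eventually.of_forall fun s => ?_)
      by_cases hs : s ∈ between a t <;> simp [S, ht, hs, f, Set.indicator]
    · simp [S, ht, Set.indicator]
  have h2 : ∀ s : ℝ, ∫ t, S.indicator f (t, s) = (between a b).indicator
      (fun s => Q s * ∫ t in between s b, evol Q s t * g t) s := by
    intro s
    have hmem : ∀ t : ℝ, (t, s) ∈ S ↔ s ∈ between a b ∧ t ∈ between s b := by
      intro t
      simp only [S, between, Set.mem_ofPred_eq]
      exact ⟨fun ⟨⟨_, h2⟩, h3, h4⟩ => ⟨⟨h3, h4.trans h2⟩, h4, h2⟩,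
        fun ⟨⟨h1, _⟩, h3, h4⟩ => ⟨⟨h1.trans h3, h4⟩, h1, h3⟩⟩
    by_cases hs : s ∈ between a b
    · rw [Set.indicator_of_mem hs, ← integral_const_mul_of_integrable (hti s).integrableOn,
        ← integral_indicator (measurableSet_between s b)]
      refine integral_congr_ae (Filter.Eventually.of_forall fun t => ?_)
      by_cases ht : t ∈ between s b <;> simp [hmem, hs, ht, f, Set.indicator, mul_assoc]
    · simp [hmem, hs, Set.indicator]
  simp only [h1, h2] at hswap
  rwa [integral_indicator (measurableSet_between a b),
    integral_indicator (measurableSet_between a b)] at hswap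

theorem integrable_evol_mul {g : ℝ → A} (hg : Integrable g) (a : EReal) :
    Integrable fun t : ℝ => evol Q a t * g t := by
  obtain ⟨K, hK0, hK⟩ := h.exists_norm_evol_le
  exact hg.bdd_mul (c := K) ((h.stronglyMeasurable_evol.comp_measurable
    (measurable_const.prodMk measurable_coe_real_ereal)).aestronglyMeasurable)
    (Filter.Eventually.of_forall fun t => hK _ _)

theorem stronglyMeasurable_integral_evol_mul {g : ℝ → A} (hgm : StronglyMeasurable g)
    (b : EReal) :
    StronglyMeasurable fun a : EReal => ∫ t in between a b, evol Q a t * g t := by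
  have hS : MeasurableSet {z : EReal × ℝ | z.2 ∈ between z.1 b} :=
    (measurableSet_lt measurable_fst (measurable_coe_real_ereal.comp measurable_snd)).inter
      (measurableSet_lt (measurable_coe_real_ereal.comp measurable_snd) measurable_const)
  have hm : StronglyMeasurable fun z : EReal × ℝ => evol Q z.1 (z.2 : EReal) * g z.2 :=
    (h.stronglyMeasurable_evol.comp_measurable
      (measurable_fst.prodMk (measurable_coe_real_ereal.comp measurable_snd))).mul
      (hgm.comp_measurable measurable_snd)
  convert (hm.indicator hS).integral_prod_right' (ν := volume) using 2 with a
  rw [← integral_indicator (measurableSet_between _ _)]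
  rfl

/-- Duhamel's formula for the inhomogeneous Volterra equation. -/
theorem duhamel {E : EReal → A} {g : ℝ → A} {C : ℝ} {c : A} {b : EReal}
    (hgm : StronglyMeasurable g) (hg : Integrable g) (hEm : StronglyMeasurable E)
    (hEC : ∀ a, ‖E a‖ ≤ C)
    (hE : ∀ a, E a = c + ∫ t in between a b, (Q t * E t + g t)) (a : EReal) :
    E a = evol Q a b * c + ∫ t in between a b, evol Q a t * g t := by
  obtain ⟨K, hK0, hK⟩ := h.exists_norm_evol_le
  let I : EReal → A := fun a => ∫ t in between a b, evol Q a t * g t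
  -- The proposed solution. It is bounded and solves the same equation as `E`, so the difference
  -- solves the homogeneous equation and vanishes.
  let R : EReal → A := fun a => evol Q a b * c + I a
  have hIm : StronglyMeasurable I := h.stronglyMeasurable_integral_evol_mul hgm b
  have hIC : ∀ a, ‖I a‖ ≤ K * ∫ t, ‖g t‖ := by
    intro a
    rw [← integral_const_mul]
    refine (norm_integral_le_integral_norm _).trans
      ((setIntegral_mono_set (h.integrable_evol_mul hg a).norm.integrableOn
        (Filter.Eventually.of_forall fun _ => norm_nonneg _) (s := between a b) (t := Set.univ)
        (Set.subset_univ _).eventuallyLE).trans ?_)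
    rw [Measure.restrict_univ]
    refine integral_mono (h.integrable_evol_mul hg a).norm (hg.norm.const_mul K) fun t => ?_
    exact (norm_mul_le _ _).trans (mul_le_mul_of_nonneg_right (hK _ _) (norm_nonneg _))
  have hRm : StronglyMeasurable R :=
    ((h.stronglyMeasurable_evol.comp_measurable (measurable_id.prodMk measurable_const)).mul_const
      c).add hIm
  have hRC : ∀ a, ‖R a‖ ≤ K * ‖c‖ + K * ∫ t, ‖g t‖ := fun a =>
    (norm_add_le _ _).trans (add_le_add ((norm_mul_le _ _).trans
      (mul_le_mul_of_nonneg_right (hK _ _) (norm_nonneg _))) (hIC a))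
  have hQi : ∀ {X : EReal → A} {C : ℝ}, StronglyMeasurable X → (∀ a, ‖X a‖ ≤ C) →
      Integrable fun t : ℝ => Q t * X t := fun hX hXC =>
    h.intQ.mul_bdd (hX.comp_measurable measurable_coe_real_ereal).aestronglyMeasurable
      (Filter.Eventually.of_forall fun t => hXC t)
  have hVm : StronglyMeasurable fun s : EReal => evol Q s b :=
    h.stronglyMeasurable_evol.comp_measurable (measurable_id.prodMk measurable_const)
  have hR : ∀ a, R a = c + ∫ t in between a b, (Q t * R t + g t) := by
    intro a
    have hI : I a = (∫ t in between a b, g t) + ∫ s in between a b, Q s * I s := by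
      -- Inserting the integral equation of `evol` produces a double integral, and exchanging its
      -- order on the triangle recovers `I`.
      have e1 : ∀ t : ℝ, evol Q a t * g t =
          g t + (∫ s in between a t, Q s * evol Q s t) * g t := fun t => by
        rw [h.evol_eq a t, add_mul, one_mul]
      have e2 : Integrable fun t : ℝ => (∫ s in between a t, Q s * evol Q s t) * g t := by
        have := (h.integrable_evol_mul hg a).sub hg
        refine this.congr (Filter.Eventually.of_forall fun t => ?_)
        simp [e1]
      simp only [I]
      simp_rw [e1]
      rw [integral_add hg.integrableOn e2.integrableOn, h.integral_triangle hgm hg]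
    have hV : evol Q a b * c = c + ∫ t in between a b, Q t * (evol Q t b * c) := by
      rw [h.evol_eq a b, add_mul, one_mul,
        ← integral_mul_const_of_integrable (hQi hVm fun a => hK a b).integrableOn]
      simp only [mul_assoc]
    have i1 : Integrable fun t : ℝ => Q t * (evol Q t b * c) := by
      simpa only [mul_assoc] using (hQi hVm fun a => hK a b).mul_const c
    have i2 : Integrable fun t : ℝ => Q t * I t := hQi hIm hIC
    simp only [R, mul_add]
    rw [integral_add (f := fun t : ℝ => Q t * (evol Q t b * c) + Q t * I t)
        (i1.add i2).integrableOn hg.integrableOn,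
      integral_add i1.integrableOn i2.integrableOn, hV, hI]
    abel
  have hdiff : E a - R a = 0 := by
    refine h.volterra_unique (D := fun a => E a - R a) b
      (fun a => (norm_sub_le _ _).trans (add_le_add (hEC a) (hRC a))) (fun a => ?_) a
    have i1 := (hQi hEm hEC).add hg
    have i2 := (hQi hRm hRC).add hg
    rw [hE a, hR a, add_sub_add_left_eq_sub,
      ← integral_sub (f := fun t : ℝ => Q t * E t + g t)
        (g := fun t : ℝ => Q t * R t + g t) i1.integrableOn i2.integrableOn]
    refine integral_congr_ae (Filter.Eventually.of_forall fun t => ?_)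
    simp [mul_sub]
  exact sub_eq_zero.1 hdiff

/-- The j + 1 propagators are uniformly bounded, so a constant times ∏ ‖T(xᵢ)‖ is an integrable
majorant. -/
theorem integrable_linked (j : ℕ) {f : (Fin j → ℝ) → ℂ} {C : ℝ} (hfm : StronglyMeasurable f)
    (hf : ∀ x, ‖f x‖ ≤ C) (a b : EReal) :
    Integrable fun x : Fin j → ℝ => f x • linked Q T b j a x := by
  obtain ⟨K, hK0, hK⟩ := h.exists_norm_evol_le
  have hle : ∀ j a (x : Fin j → ℝ), ‖linked Q T b j a x‖ ≤ K ^ (j + 1) * ∏ i, ‖T (x i)‖ := by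
    intro j
    induction j with
    | zero => simpa [linked] using fun a => hK a b
    | succ j ih =>
      intro a x
      rw [linked, Fin.prod_univ_succ]
      calc ‖evol Q a (x 0) * T (x 0) * linked Q T b j (x 0) (Fin.tail x)‖
          ≤ ‖evol Q a (x 0)‖ * ‖T (x 0)‖ * ‖linked Q T b j (x 0) (Fin.tail x)‖ :=
            (norm_mul_le _ _).trans
              (mul_le_mul_of_nonneg_right (norm_mul_le _ _) (norm_nonneg _))
        _ ≤ K * ‖T (x 0)‖ * (K ^ (j + 1) * ∏ i, ‖T (Fin.tail x i)‖) := by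
            gcongr
            · exact hK _ _
            · exact ih _ _
        _ = K ^ (j + 1 + 1) * (‖T (x 0)‖ * ∏ i : Fin j, ‖T (x i.succ)‖) := by
            simp only [Fin.tail]
            ring
  have hm : StronglyMeasurable fun x : Fin j → ℝ => f x • linked Q T b j a x :=
    hfm.smul ((h.zero_right.stronglyMeasurable_linked h.measT b j).comp_measurable
      measurable_prodMk_left)
  refine Integrable.mono' ((Integrable.fintype_prod fun _ => h.intT.norm).const_mul
    (C * K ^ (j + 1))) hm.aestronglyMeasurable (Filter.Eventually.of_forall fun x => ?_)
  rw [norm_smul, mul_assoc]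
  exact mul_le_mul (hf x) (hle j a x) (norm_nonneg _) ((norm_nonneg _).trans (hf x))

/-- The Dyson series, resummed in the powers of `Q` between consecutive factors `T`. -/
theorem dyson_eq_sum (N : ℕ) {F : Amplitudes} {C : ℝ} (hF : Admissible F C)
    (hN : ∀ j, N ≤ j → F j = 0) (a b : EReal) :
    dyson Q T F a b =
      ∑ j ∈ Finset.range N, ∫ x in chain j a b, F j x • linked Q T b j a x := by
  induction N generalizing F a with
  | zero =>
    have : F = 0 := funext fun j => hN j (Nat.zero_le j)
    simp [this, dyson_zero_right]
  | succ N ih =>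
    obtain ⟨K, hK0, hK⟩ := h.exists_norm_dyson_le
    have hdm : StronglyMeasurable fun q : ℝ × (EReal × EReal) =>
        dyson Q T (shift q.1 F) q.2.1 q.2.2 :=
      h.stronglyMeasurable_dyson (fun j => (hF.measurable (j + 1)).comp_measurable
        (measurable_finCons j)) (fun t => (hF.shift t).norm_le)
    have hsm : StronglyMeasurable fun t : ℝ => dyson Q T (shift t F) t b :=
      hdm.comp_measurable
        (measurable_id.prodMk (measurable_coe_real_ereal.prodMk measurable_const))
    have hEm : StronglyMeasurable fun a : EReal => dyson Q T F a b :=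
      (h.stronglyMeasurable_dyson (P := Unit) (F := fun _ => F)
        (fun j => (hF.measurable j).comp_measurable measurable_snd)
        (fun _ => hF.norm_le)).comp_measurable
        ((measurable_const (a := ())).prodMk (measurable_id.prodMk measurable_const))
    have hgi : Integrable fun t : ℝ => T t * dyson Q T (shift t F) t b :=
      h.intT.mul_bdd (c := C * K) hsm.aestronglyMeasurable
        (Filter.Eventually.of_forall fun t => hK _ C (hF.shift t) _ _)
    -- Duhamel isolates the first T: the inhomogeneity contains only `shift t F`, which vanishes
    -- from degree `N` on and falls under the induction hypothesis. The constant term gives j = 0.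
    have key := h.duhamel (E := fun a => dyson Q T F a b) (h.measT.mul hsm) hgi hEm
      (fun a => hK F C hF a b) (fun a => h.dyson_eq hF a b) a
    have hi : ∀ j, IntegrableOn (fun x => F j x • linked Q T b j a x) (chain j a b) := fun j =>
      (h.integrable_linked j (hF.measurable j) (hF.norm_le j) a b).integrableOn
    rw [key, Finset.sum_range_succ', integral_chain_zero, add_comm]
    congr 1
    · rw [show (∑ j ∈ Finset.range N, ∫ x in chain (j + 1) a b,
          F (j + 1) x • linked Q T b (j + 1) a x) = ∑ j ∈ Finset.range N, ∫ t in between a b,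
          ∫ y in chain j t b, F (j + 1) (Fin.cons t y) • linked Q T b (j + 1) a (Fin.cons t y)
          from Finset.sum_congr rfl fun j _ => integral_chain_succ (hi (j + 1)),
        ← integral_finsetSum _ fun j _ => integrableOn_integral_chain (hi (j + 1))]
      refine integral_congr_ae (Filter.Eventually.of_forall fun t => ?_)
      simp only [Pi.mul_apply]
      rw [ih (hF.shift t) (fun j hj => by
        funext y
        simp [shift, hN (j + 1) (by omega)]) t, ← mul_assoc, Finset.mul_sum]
      refine Finset.sum_congr rfl fun j _ => ?_
      rw [← integral_const_mul_of_integrable (h.integrable_linked j ((hF.shift t).measurable j)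
        ((hF.shift t).norm_le j) t b).integrableOn]
      simp only [linked_cons, shift, mul_smul_comm]
    · simp [linked]

end Tensors

end

section
/-! ### Symmetric integrands on the box -/

theorem boxMeasure_eq_restrict (ℓ : ℝ≥0∞) (n : ℕ) :
    boxMeasure ℓ n = volume.restrict (Set.univ.pi fun _ => box ℓ) := by
  rw [boxMeasure, volume_pi, Measure.restrict_pi_pi]

theorem measurableSet_univ_pi_box (ℓ : ℝ≥0∞) (n : ℕ) :
    MeasurableSet (Set.univ.pi fun _ : Fin n => box ℓ) :=
  MeasurableSet.univ_pi fun _ => measurableSet_box ℓ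

theorem integral_boxMeasure_eq {ℓ : ℝ≥0∞} {n : ℕ} {E : Type*} [NormedAddCommGroup E]
    [NormedSpace ℝ E] {g : (Fin n → ℝ) → E} (hg : Integrable g (boxMeasure ℓ n))
    (hs : ∀ (σ : Equiv.Perm (Fin n)) x, g (x ∘ σ) = g x) :
    ∫ x, g x ∂boxMeasure ℓ n = n.factorial • ∫ x in simplex n (box ℓ), g x := by
  have hm := measurableSet_univ_pi_box ℓ n
  rw [boxMeasure_eq_restrict] at hg ⊢
  -- The cube `Iⁿ` is invariant under permutations, so `g` cut off to it is still symmetric and the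
  -- whole-space identity applies.
  rw [← integral_indicator hm, integral_eq_factorial_smul ((integrable_indicator_iff hm).2 hg),
    setIntegral_indicator hm]
  · congr 3
    ext x
    simp [simplex]
  · intro σ x
    have : x ∘ σ ∈ (Set.univ.pi fun _ : Fin n => box ℓ) ↔
        x ∈ (Set.univ.pi fun _ : Fin n => box ℓ) := by
      simp only [Set.mem_univ_pi, Function.comp_apply]
      exact ⟨fun h i => by simpa using h (σ.symm i), fun h i => h _⟩
    by_cases hx : x ∈ (Set.univ.pi fun _ : Fin n => box ℓ)
    · rw [Set.indicator_of_mem hx, Set.indicator_of_mem (this.2 hx), hs]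
    · rw [Set.indicator_of_notMem hx, Set.indicator_of_notMem (mt this.1 hx)]

/-! ### Multiplication by symmetric phases -/

/-- Symmetric, measurable functions with values in the unit circle. -/
structure IsPhase {n : ℕ} (u : (Fin n → ℝ) → ℂ) : Prop where
  measurable : StronglyMeasurable u
  norm_eq_one : ∀ x, ‖u x‖ = 1
  symm : ∀ (σ : Equiv.Perm (Fin n)) x, u (x ∘ σ) = u x

theorem IsPhase.conj {n : ℕ} {u : (Fin n → ℝ) → ℂ} (hu : IsPhase u) :
    IsPhase fun x => starRingEnd ℂ (u x) where
  measurable := Complex.continuous_conj.comp_stronglyMeasurable hu.measurable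
  norm_eq_one x := by simpa using hu.norm_eq_one x
  symm σ x := by rw [hu.symm]

/-- A function of modulus one on ordered configurations extends to a symmetric phase. -/
theorem exists_isPhase {ℓ : ℝ≥0∞} {n : ℕ} {c : (Fin n → ℝ) → ℂ}
    (hc : AEStronglyMeasurable c (volume.restrict (simplex n (box ℓ))))
    (h1 : ∀ x ∈ simplex n (box ℓ), ‖c x‖ = 1) :
    ∃ u, IsPhase u ∧ u =ᵐ[volume.restrict (simplex n (box ℓ))] c := by
  have hS : MeasurableSet (simplex n (box ℓ)) := measurableSet_simplex (measurableSet_box ℓ)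
  set S := simplex n (box ℓ)
  let v : (Fin n → ℝ) → ℂ := fun x => ∑ σ : Equiv.Perm (Fin n), S.indicator (hc.mk c) (x ∘ σ)
  have hv : StronglyMeasurable v := by
    refine Finset.stronglyMeasurable_fun_sum _ fun σ _ => ?_
    exact (hc.stronglyMeasurable_mk.indicator hS).comp_measurable
      (measurableEmbedding_perm σ).measurable
  have hvs : ∀ (τ : Equiv.Perm (Fin n)) x, v (x ∘ τ) = v x := fun τ x =>
    Equiv.sum_comp (Equiv.mulLeft τ) fun σ : Equiv.Perm (Fin n) =>
      S.indicator (hc.mk c) (x ∘ σ)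
  have hvS : ∀ x ∈ S, v x = hc.mk c x := by
    intro x hx
    -- At an ordered configuration, the identity is the only permutation that leaves the points
    -- ordered.
    simp only [v]
    rw [Finset.sum_eq_single 1]
    · simp [hx]
    · intro σ _ hσ
      refine Set.indicator_of_notMem (fun h => hσ ?_) _
      exact perm_eq_of_strictMono (x := x) h.1 (by simpa using hx.1)
    · simp
  -- The value 1 elsewhere makes the modulus one everywhere; symmetry survives because the condition
  -- on `v` is itself symmetric.
  refine ⟨fun x => if ‖v x‖ = 1 then v x else 1, ⟨?_, ?_, ?_⟩, ?_⟩
  · exact StronglyMeasurable.ite (hv.norm.measurable (measurableSet_singleton 1)) hv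
      stronglyMeasurable_const
  · intro x
    by_cases h : ‖v x‖ = 1 <;> simp [h]
  · intro σ x
    simp only [hvs]
  · filter_upwards [hc.ae_eq_mk, ae_restrict_mem hS] with x hx hxS
    have : v x = c x := by rw [hvS x hxS, hx]
    simp [this, h1 x hxS]

section Multiplication

variable {ℓ : ℝ≥0∞} {n : ℕ} {u : (Fin n → ℝ) → ℂ} (hu : IsPhase u)
include hu

theorem IsPhase.memLp_mul (f : Lp ℂ 2 (boxMeasure ℓ n)) :
    MemLp (fun x => u x * f x) 2 (boxMeasure ℓ n) :=
  (Lp.memLp f).of_le (hu.measurable.aestronglyMeasurable.mul (Lp.aestronglyMeasurable f))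
    (Filter.Eventually.of_forall fun x => by simp [hu.norm_eq_one])

/-- Multiplication by a phase, on `L²(Iⁿ)`. -/
def mulLp (f : Lp ℂ 2 (boxMeasure ℓ n)) : Lp ℂ 2 (boxMeasure ℓ n) := (hu.memLp_mul f).toLp

theorem coeFn_mulLp (f : Lp ℂ 2 (boxMeasure ℓ n)) :
    mulLp hu f =ᵐ[boxMeasure ℓ n] fun x => u x * f x := (hu.memLp_mul f).coeFn_toLp

theorem norm_mulLp (f : Lp ℂ 2 (boxMeasure ℓ n)) : ‖mulLp hu f‖ = ‖f‖ := by
  rw [Lp.norm_def, Lp.norm_def, eLpNorm_congr_ae (coeFn_mulLp hu f)]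
  congr 1
  exact eLpNorm_congr_norm_ae (Filter.Eventually.of_forall fun x => by simp [hu.norm_eq_one])

theorem mulLp_add (f g : Lp ℂ 2 (boxMeasure ℓ n)) :
    mulLp hu (f + g) = mulLp hu f + mulLp hu g := by
  apply Lp.ext
  filter_upwards [coeFn_mulLp hu (f + g), coeFn_mulLp hu f, coeFn_mulLp hu g,
    Lp.coeFn_add f g, Lp.coeFn_add (mulLp hu f) (mulLp hu g)] with x h1 h2 h3 h4 h5
  rw [h1, h5, h4, Pi.add_apply, Pi.add_apply, h2, h3, mul_add]

theorem mulLp_smul (c : ℂ) (f : Lp ℂ 2 (boxMeasure ℓ n)) :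
    mulLp hu (c • f) = c • mulLp hu f := by
  apply Lp.ext
  filter_upwards [coeFn_mulLp hu (c • f), coeFn_mulLp hu f, Lp.coeFn_smul c f,
    Lp.coeFn_smul c (mulLp hu f)] with x h1 h2 h3 h4
  rw [h1, h4, h3, Pi.smul_apply, Pi.smul_apply, h2, smul_eq_mul, smul_eq_mul, mul_left_comm]

theorem mulLp_conj_mulLp (f : Lp ℂ 2 (boxMeasure ℓ n)) : mulLp hu.conj (mulLp hu f) = f := by
  apply Lp.ext
  filter_upwards [coeFn_mulLp hu.conj (mulLp hu f), coeFn_mulLp hu f] with x h1 h2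
  rw [h1, h2, ← mul_assoc, Complex.conj_mul', hu.norm_eq_one]
  simp

theorem mulLp_mulLp_conj (f : Lp ℂ 2 (boxMeasure ℓ n)) : mulLp hu (mulLp hu.conj f) = f := by
  apply Lp.ext
  filter_upwards [coeFn_mulLp hu (mulLp hu.conj f), coeFn_mulLp hu.conj f] with x h1 h2
  rw [h1, h2, ← mul_assoc, Complex.mul_conj', hu.norm_eq_one]
  simp

omit hu in
theorem coeFn_permute (σ : Equiv.Perm (Fin n)) (f : Lp ℂ 2 (boxMeasure ℓ n)) :
    permute ℓ σ f =ᵐ[boxMeasure ℓ n] fun x => f (x ∘ σ) :=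
  Lp.coeFn_compMeasurePreserving f (measurePreserving_perm ℓ σ)

theorem permute_mulLp (σ : Equiv.Perm (Fin n)) (f : Lp ℂ 2 (boxMeasure ℓ n)) :
    permute ℓ σ (mulLp hu f) = mulLp hu (permute ℓ σ f) := by
  apply Lp.ext
  filter_upwards [coeFn_permute σ (mulLp hu f), coeFn_mulLp hu (permute ℓ σ f),
    coeFn_permute σ f, (measurePreserving_perm ℓ σ).quasiMeasurePreserving.ae_eq_comp
      (coeFn_mulLp hu f)] with x h1 h2 h3 h4
  simp only [Function.comp_apply] at h4
  rw [h1, h2, h3, h4, hu.symm]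

/-- Multiplication by a symmetric phase, on the `n`-particle space. -/
def mulSector (f : Sector ℓ n) : Sector ℓ n :=
  ⟨mulLp hu f.1, fun σ => by rw [permute_mulLp, f.2 σ]⟩

theorem norm_mulSector (f : Sector ℓ n) : ‖mulSector hu f‖ = ‖f‖ := norm_mulLp hu f.1

end Multiplication

/-! ### Phase multiplication on Fock space and its matrix elements -/

section FockMultiplication

variable {ℓ : ℝ≥0∞} {u : (n : ℕ) → (Fin n → ℝ) → ℂ} (hu : ∀ n, IsPhase (u n))

/-- Multiplication of the `n`-particle wavefunctions by symmetric phases, on Fock space. -/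
def mulFock (Φ : Fock ℓ) : Fock ℓ :=
  ⟨fun n => mulSector (hu n) (Φ n), by
    have h := (memℓp_gen_iff (by norm_num)).1 (lp.memℓp Φ)
    exact (memℓp_gen_iff (by norm_num)).2 (by simpa only [norm_mulSector] using h)⟩

theorem norm_mulFock (Φ : Fock ℓ) : ‖mulFock hu Φ‖ = ‖Φ‖ := by
  rw [lp.norm_eq_tsum_rpow (by norm_num), lp.norm_eq_tsum_rpow (by norm_num)]
  simp only [mulFock, norm_mulSector]

/-- Multiplication by symmetric phases as a unitary operator. -/
def mulFockₗᵢ : Fock ℓ ≃ₗᵢ[ℂ] Fock ℓ where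
  toFun := mulFock hu
  invFun := mulFock fun n => (hu n).conj
  map_add' Φ Ψ := by
    ext n : 3
    exact mulLp_add (hu n) _ _
  map_smul' c Φ := by
    ext n : 3
    exact mulLp_smul (hu n) c _
  left_inv Φ := by
    ext n : 3
    exact mulLp_conj_mulLp (hu n) _
  right_inv Φ := by
    ext n : 3
    exact mulLp_mulLp_conj (hu n) _
  norm_map' := norm_mulFock hu

/-- Multiplication by symmetric phases as a bounded operator. -/
def mulFockL : Fock ℓ →L[ℂ] Fock ℓ := (mulFockₗᵢ hu).toContinuousLinearEquiv.toContinuousLinearMap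

theorem mulFockL_mem_unitary : mulFockL hu ∈ unitary (Fock ℓ →L[ℂ] Fock ℓ) :=
  (Unitary.linearIsometryEquiv.symm (mulFockₗᵢ (ℓ := ℓ) hu)).2

theorem wavefunction_mulFockL (Φ : Fock ℓ) (n : ℕ) :
    wavefunction (mulFockL hu Φ) n =ᵐ[boxMeasure ℓ n] fun x => u n x * wavefunction Φ n x :=
  coeFn_mulLp (hu n) _

theorem wavefunction_toFock (Φ : TestVector) (n : ℕ) :
    wavefunction (toFock ℓ Φ) n =ᵐ[boxMeasure ℓ n] Φ.1 n :=
  ((Φ.2.1 n).memLp_of_hasCompactSupport (Φ.2.2.1 n)).coeFn_toLp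

/-- The amplitudes `⟨Φ|ψ†(x₁)⋯ψ†(xⱼ)|Ω⟩⟨Ω|ψ(xⱼ)⋯ψ(x₁)|Ψ⟩ = j! conj(Φⱼ) Ψⱼ`. -/
def pairing (Φ Ψ : TestVector) : (j : ℕ) → (Fin j → ℝ) → ℂ := fun j x =>
  j.factorial * (starRingEnd ℂ (Φ.1 j x) * Ψ.1 j x)

theorem continuous_pairing (Φ Ψ : TestVector) (j : ℕ) : Continuous (pairing Φ Ψ j) :=
  continuous_const.mul ((Complex.continuous_conj.comp (Φ.2.1 j)).mul (Ψ.2.1 j))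

theorem hasCompactSupport_pairing (Φ Ψ : TestVector) (j : ℕ) :
    HasCompactSupport (pairing Φ Ψ j) :=
  ((Ψ.2.2.1 j).mul_left (f := fun x => starRingEnd ℂ (Φ.1 j x))).mul_left


/-- In each sector the inner product is an integral over `Iʲ` of a symmetric function. Restricting
it to ordered configurations costs j!, which is the factor in `pairing`. -/
theorem inner_mulFockL (Φ Ψ : TestVector) :
    HasSum (fun j => ∫ x in simplex j (box ℓ), u j x * pairing Φ Ψ j x)
      (inner ℂ (toFock ℓ Φ) (mulFockL hu (toFock ℓ Ψ))) := by
  refine (lp.hasSum_inner (toFock ℓ Φ) (mulFockL hu (toFock ℓ Ψ))).congr_fun fun j => ?_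
  have h1 : inner ℂ (toFock ℓ Φ j) (mulFockL hu (toFock ℓ Ψ) j) =
      ∫ x, u j x * (starRingEnd ℂ (Φ.1 j x) * Ψ.1 j x) ∂boxMeasure ℓ j := by
    rw [Submodule.coe_inner, L2.inner_def]
    refine integral_congr_ae ?_
    filter_upwards [wavefunction_toFock (ℓ := ℓ) Φ j, wavefunction_toFock (ℓ := ℓ) Ψ j,
      wavefunction_mulFockL hu (toFock ℓ Ψ) j] with x e1 e2 e3
    simp only [wavefunction] at e1 e2 e3
    rw [e1, e3, e2, RCLike.inner_apply]
    ring
  have hc : Continuous fun x => starRingEnd ℂ (Φ.1 j x) * Ψ.1 j x :=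
    (Complex.continuous_conj.comp (Φ.2.1 j)).mul (Ψ.2.1 j)
  have hcs : HasCompactSupport fun x => starRingEnd ℂ (Φ.1 j x) * Ψ.1 j x :=
    (Ψ.2.2.1 j).mul_left (f := fun x => starRingEnd ℂ (Φ.1 j x))
  rw [h1, integral_boxMeasure_eq]
  · rw [nsmul_eq_mul, ← integral_const_mul]
    refine integral_congr_ae (Filter.Eventually.of_forall fun x => ?_)
    simp only [pairing]
    ring
  · exact (hc.integrable_of_hasCompactSupport hcs).bdd_mul (c := 1)
      (hu j).measurable.aestronglyMeasurable
      (Filter.Eventually.of_forall fun x => ((hu j).norm_eq_one x).le)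
  · intro σ x
    rw [(hu j).symm, Φ.2.2.2.1 j σ x, Ψ.2.2.2.1 j σ x]

end FockMultiplication

/-! ### Density of the test vectors -/

section Density

variable {ℓ : ℝ≥0∞} {n : ℕ}

/-- The symmetrization of a function. -/
def symmetrize (g : (Fin n → ℝ) → ℂ) : (Fin n → ℝ) → ℂ := fun x =>
  (n.factorial : ℂ)⁻¹ * ∑ σ : Equiv.Perm (Fin n), g (x ∘ σ)

theorem symmetrize_comp_perm (g : (Fin n → ℝ) → ℂ) (τ : Equiv.Perm (Fin n)) (x : Fin n → ℝ) :
    symmetrize g (x ∘ τ) = symmetrize g x := by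
  unfold symmetrize
  congr 1
  exact Equiv.sum_comp (Equiv.mulLeft τ) fun σ : Equiv.Perm (Fin n) => g (x ∘ σ)

theorem continuous_symmetrize {g : (Fin n → ℝ) → ℂ} (hg : Continuous g) :
    Continuous (symmetrize g) := by
  refine continuous_const.mul (continuous_finsetSum _ fun σ _ => hg.comp ?_)
  exact continuous_pi fun i => continuous_apply (σ i)

theorem hasCompactSupport_symmetrize {g : (Fin n → ℝ) → ℂ} (hg : HasCompactSupport g) :
    HasCompactSupport (symmetrize g) := by
  refine HasCompactSupport.mul_left (f := fun _ => (n.factorial : ℂ)⁻¹) ?_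
  have h : ∀ s : Finset (Equiv.Perm (Fin n)),
      HasCompactSupport fun x : Fin n → ℝ => ∑ σ ∈ s, g (x ∘ σ) := by
    intro s
    induction s using Finset.induction_on with
    | empty =>
      simp only [Finset.sum_empty]
      exact HasCompactSupport.zero
    | insert σ s hσ ih =>
      simp only [Finset.sum_insert hσ]
      refine HasCompactSupport.add ?_ ih
      have h := hg.comp_homeomorph (Homeomorph.piCongrLeft (Y := fun _ => ℝ) σ.symm)
      have e : (g ∘ Homeomorph.piCongrLeft (Y := fun _ => ℝ) σ.symm) = fun x => g (x ∘ σ) := by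
        funext x
        simp only [Function.comp_apply]
        congr 1
        funext i
        have := Equiv.piCongrLeft_apply_apply (P := fun _ => ℝ) σ.symm x (σ i)
        rw [Equiv.symm_apply_apply] at this
        exact this
      rwa [e] at h
  exact h _

/-- Since `f` is symmetric, `f - symmetrize g` is the average of the permuted copies of `f - g`, all
of the same norm. Symmetrizing an approximant therefore never worsens it. -/
theorem norm_sub_symmetrize_le (f : Sector ℓ n) {g : (Fin n → ℝ) → ℂ}
    (hg : MemLp g 2 (boxMeasure ℓ n)) (hsg : MemLp (symmetrize g) 2 (boxMeasure ℓ n)) :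
    ‖(f : Lp ℂ 2 (boxMeasure ℓ n)) - hsg.toLp‖ ≤ ‖(f : Lp ℂ 2 (boxMeasure ℓ n)) - hg.toLp‖ := by
  have hfac : (n.factorial : ℂ) ≠ 0 := by exact_mod_cast n.factorial_ne_zero
  have h1 : hsg.toLp = (n.factorial : ℂ)⁻¹ • ∑ σ : Equiv.Perm (Fin n), permute ℓ σ hg.toLp := by
    apply Lp.ext
    have hp : ∀ᵐ x ∂boxMeasure ℓ n, ∀ σ : Equiv.Perm (Fin n),
        permute ℓ σ hg.toLp x = g (x ∘ σ) := by
      rw [ae_all_iff]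
      intro σ
      filter_upwards [coeFn_permute σ hg.toLp,
        (measurePreserving_perm ℓ σ).quasiMeasurePreserving.ae_eq_comp hg.coeFn_toLp]
        with x e1 e2
      rw [e1]
      exact e2
    filter_upwards [hsg.coeFn_toLp, hp, Lp.coeFn_smul (n.factorial : ℂ)⁻¹
      (∑ σ : Equiv.Perm (Fin n), permute ℓ σ hg.toLp),
      Lp.coeFn_finsetSum Finset.univ fun σ : Equiv.Perm (Fin n) => permute ℓ σ hg.toLp]
      with x e1 e2 e3 e4
    rw [e1, e3, Pi.smul_apply, e4, Finset.sum_apply]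
    simp [e2, symmetrize]
  have h2 : (f : Lp ℂ 2 (boxMeasure ℓ n)) - hsg.toLp = (n.factorial : ℂ)⁻¹ •
      ∑ σ : Equiv.Perm (Fin n), permute ℓ σ ((f : Lp ℂ 2 (boxMeasure ℓ n)) - hg.toLp) := by
    have hf : ∀ σ, permute ℓ σ (f : Lp ℂ 2 (boxMeasure ℓ n)) = f := f.2
    rw [h1]
    simp only [map_sub, hf, Finset.sum_sub_distrib, smul_sub, Finset.sum_const,
      Finset.card_univ, Fintype.card_perm, Fintype.card_fin]
    rw [← Nat.cast_smul_eq_nsmul ℂ, smul_smul, inv_mul_cancel₀ hfac, one_smul]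
  rw [h2, norm_smul]
  calc _ ≤ ‖(n.factorial : ℂ)⁻¹‖ * ∑ σ : Equiv.Perm (Fin n),
        ‖permute ℓ σ ((f : Lp ℂ 2 (boxMeasure ℓ n)) - hg.toLp)‖ := by
        gcongr
        exact norm_sum_le _ _
    _ = _ := by
        simp only [LinearIsometry.norm_map, Finset.sum_const, Finset.card_univ,
          Fintype.card_perm, Fintype.card_fin, nsmul_eq_mul, norm_inv, Complex.norm_natCast]
        rw [← mul_assoc, inv_mul_cancel₀ (by exact_mod_cast n.factorial_ne_zero), one_mul]

/-- The test vector with a single nonzero wavefunction. -/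
def singleTest (g : (Fin n → ℝ) → ℂ) (hc : Continuous g) (hs : HasCompactSupport g)
    (hp : ∀ (σ : Equiv.Perm (Fin n)) x, g (x ∘ σ) = g x) : TestVector :=
  ⟨Pi.single n g, by
    refine ⟨fun m => ?_, fun m => ?_, fun m => ?_, (Set.finite_singleton n).subset fun m hm => ?_⟩
    · by_cases h : m = n
      · subst h
        simpa using hc
      · rw [Pi.single_eq_of_ne h]
        exact continuous_const
    · by_cases h : m = n
      · subst h
        simpa using hs
      · rw [Pi.single_eq_of_ne h]
        exact HasCompactSupport.zero
    · by_cases h : m = n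
      · subst h
        simpa using hp
      · rw [Pi.single_eq_of_ne h]
        exact fun _ _ => rfl
    · by_contra h
      exact hm (Pi.single_eq_of_ne h _)⟩

theorem norm_single_sub_toFock (f : Sector ℓ n) (g : (Fin n → ℝ) → ℂ) (hc : Continuous g)
    (hs : HasCompactSupport g) (hp : ∀ (σ : Equiv.Perm (Fin n)) x, g (x ∘ σ) = g x)
    (hL : MemLp g 2 (boxMeasure ℓ n)) :
    ‖lp.single 2 n f - toFock ℓ (singleTest g hc hs hp)‖ =
      ‖(f : Lp ℂ 2 (boxMeasure ℓ n)) - hL.toLp‖ := by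
  let g' : Sector ℓ n := toFock ℓ (singleTest g hc hs hp) n
  have hg' : (g' : Lp ℂ 2 (boxMeasure ℓ n)) = hL.toLp := by
    apply Lp.ext
    refine (wavefunction_toFock (ℓ := ℓ) (singleTest g hc hs hp) n).trans ?_
    refine Filter.EventuallyEq.trans ?_ hL.coeFn_toLp.symm
    simp [singleTest]
  have h : toFock ℓ (singleTest g hc hs hp) = lp.single 2 n g' := by
    ext m : 2
    by_cases h : m = n
    · subst h
      rw [lp.single_apply_self]
    · rw [lp.single_apply_ne _ _ _ h]
      ext1
      apply Lp.ext
      refine (wavefunction_toFock (ℓ := ℓ) (singleTest g hc hs hp) m).trans ?_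
      have : (singleTest g hc hs hp).1 m = 0 := Pi.single_eq_of_ne h _
      rw [this]
      exact (Lp.coeFn_zero _ _ _).symm
  rw [h, ← hg', ← lp.single_sub, lp.norm_single (by norm_num)]
  rfl

/-- The test vectors span a dense subspace of Fock space. -/
theorem dense_span_range_toFock :
    Dense (Submodule.span ℂ (Set.range (toFock ℓ)) : Set (Fock ℓ)) := by
  set S := Submodule.span ℂ (Set.range (toFock ℓ))
  have hsingle : ∀ n (f : Sector ℓ n), lp.single 2 n f ∈ closure (S : Set (Fock ℓ)) := by
    intro n f
    rw [Metric.mem_closure_iff]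
    intro ε hε
    -- Ordinary density of compactly supported continuous functions in L² gives a possibly
    -- non-symmetric approximant, which is then symmetrized.
    obtain ⟨g, hgs, hgε, hgc, hgL⟩ :=
      (Lp.memLp (f : Lp ℂ 2 (boxMeasure ℓ n))).exists_hasCompactSupport_eLpNorm_sub_le
        (by norm_num) (ε := ENNReal.ofReal (ε / 2)) (by simpa using hε)
    have hsc := continuous_symmetrize hgc
    have hss := hasCompactSupport_symmetrize hgs
    have hsL : MemLp (symmetrize g) 2 (boxMeasure ℓ n) := hsc.memLp_of_hasCompactSupport hss
    refine ⟨_, Submodule.subset_span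
      ⟨singleTest (symmetrize g) hsc hss (symmetrize_comp_perm g), rfl⟩, ?_⟩
    rw [dist_eq_norm, norm_single_sub_toFock f _ hsc hss _ hsL]
    refine (norm_sub_symmetrize_le f hgL hsL).trans_lt ?_
    have : ‖(f : Lp ℂ 2 (boxMeasure ℓ n)) - hgL.toLp‖ ≤ ε / 2 := by
      have e : (f : Lp ℂ 2 (boxMeasure ℓ n)) - hgL.toLp =
          ((Lp.memLp (f : Lp ℂ 2 (boxMeasure ℓ n))).sub hgL).toLp := by
        rw [MemLp.toLp_sub (Lp.memLp _) hgL, Lp.toLp_coeFn]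
      rw [e, Lp.norm_toLp]
      exact ENNReal.toReal_le_of_le_ofReal (by positivity) hgε
    linarith
  intro Φ
  have hΦ := lp.hasSum_single (p := 2) (by norm_num) Φ
  have hcl : closure (S : Set (Fock ℓ)) = (S.topologicalClosure : Set (Fock ℓ)) := rfl
  rw [hcl]
  exact S.isClosed_topologicalClosure.mem_of_tendsto hΦ
    (Filter.Eventually.of_forall fun s => Submodule.sum_mem _ fun n _ => hsingle n _)

/-- Density is used twice: once for the input vector, and once for the vector paired with the
output. -/
theorem ext_inner_toFock {U V : Fock ℓ →L[ℂ] Fock ℓ}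
    (h : ∀ Φ Ψ, inner ℂ (toFock ℓ Φ) (U (toFock ℓ Ψ)) = inner ℂ (toFock ℓ Φ) (V (toFock ℓ Ψ))) :
    U = V := by
  refine ContinuousLinearMap.ext_on dense_span_range_toFock ?_
  rintro _ ⟨Ψ, rfl⟩
  have : innerSL ℂ (U (toFock ℓ Ψ)) = innerSL ℂ (V (toFock ℓ Ψ)) := by
    refine ContinuousLinearMap.ext_on dense_span_range_toFock ?_
    rintro _ ⟨Φ, rfl⟩
    have := congrArg (starRingEnd ℂ) (h Φ Ψ)
    simp only [inner_conj_symm] at this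
    exact this
  exact ext_inner_right ℂ fun v => congrArg (fun L => L v) this

end Density

end

section
/-! ### Matrix elements of the supermaps -/

/-- The two factors √(j+1) turn j! into (j+1)!. With the factorial included in `pairing`, applying ψ
to both vectors is a pure shift. -/
theorem pairing_psi (t : ℝ) (Φ Ψ : TestVector) :
    pairing (psi t Φ) (psi t Ψ) = shift t (pairing Φ Ψ) := by
  funext j y
  have h : ((Real.sqrt (j + 1) : ℝ) : ℂ) * ((Real.sqrt (j + 1) : ℝ) : ℂ) = j + 1 := by
    rw [← Complex.ofReal_mul, Real.mul_self_sqrt (by positivity)]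
    push_cast
    rfl
  simp only [pairing, shift, psi, LinearMap.coe_mk, AddHom.coe_mk, map_mul, Complex.conj_ofReal,
    Nat.factorial_succ, Nat.cast_mul, Nat.cast_succ]
  linear_combination (j.factorial : ℂ) * (starRingEnd ℂ (Φ.1 (j + 1) (Fin.cons t y)) *
    Ψ.1 (j + 1) (Fin.cons t y)) * h

theorem vacuum_apply (Φ Ψ : TestVector) : vacuum Φ Ψ = pairing Φ Ψ 0 Fin.elim0 := by
  simp [vacuum, pairing]

theorem adMap_apply (t : ℝ) (G : Form) (Φ Ψ : TestVector) :
    adMap t G Φ Ψ = G (psi t Φ) (psi t Ψ) := rfl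

theorem adMap_prod_vacuum {j : ℕ} (x : Fin j → ℝ) (Φ Ψ : TestVector) :
    (List.ofFn fun i => adMap (x i)).prod vacuum Φ Ψ = pairing Φ Ψ j x := by
  induction j generalizing Φ Ψ with
  | zero =>
    rw [Subsingleton.elim x Fin.elim0]
    simpa using vacuum_apply Φ Ψ
  | succ j ih =>
    rw [List.ofFn_succ, List.prod_cons, Module.End.mul_apply, adMap_apply,
      ih (fun i => x i.succ), pairing_psi]
    simp only [shift]
    congr 1
    exact Fin.cons_self_tail x

variable {D : ℕ}

theorem generator_apply (Q T : ℝ → Matrix (Fin D) (Fin D) ℂ) (t : ℝ) (r k : Fin D) (G : Form)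
    (Φ Ψ : TestVector) :
    generator Q 0 0 T t r k G Φ Ψ =
      Q t r k * G Φ Ψ + T t r k * G (psi t Φ) (psi t Ψ) := by
  simp [generator, adMap_apply]

variable {A : Type*} [NormedRing A] [NormedAlgebra ℂ A] (e : Matrix (Fin D) (Fin D) ℂ ≃ₐ[ℂ] A)

/-- Each generator either leaves both test vectors alone, with weight Q, or applies `psi` to both,
with weight T; by `pairing_psi` this is the recursion defining `word`. The isomorphism `e` serves to
carry matrices to a normed algebra. -/
theorem generator_prod_vacuum (Q T : ℝ → Matrix (Fin D) (Fin D) ℂ) {n : ℕ} (x : Fin n → ℝ)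
    (Φ Ψ : TestVector) (r c : Fin D) :
    (List.ofFn fun i => generator Q 0 0 T (x i)).prod r c vacuum Φ Ψ =
      e.symm (word (fun t => e (Q t)) (fun t => e (T t)) n (pairing Φ Ψ) x) r c := by
  induction n generalizing Φ Ψ r with
  | zero =>
    by_cases h : r = c <;> simp [word, vacuum_apply, h]
  | succ n ih =>
    rw [List.ofFn_succ, List.prod_cons, Matrix.mul_apply]
    simp only [LinearMap.sum_apply, Module.End.mul_apply,
      generator_apply, ih (fun i => x i.succ), pairing_psi, Finset.sum_add_distrib]
    simp only [word, map_add, map_mul, AlgEquiv.symm_apply_apply, Matrix.add_apply,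
      Matrix.mul_apply]
    rfl

/-- A matrix entry, as a continuous linear functional. -/
def entryL (r c : Fin D) : A →L[ℂ] ℂ :=
  haveI : FiniteDimensional ℂ A := e.toLinearEquiv.finiteDimensional
  ((Matrix.entryLinearMap ℂ ℂ r c).comp e.symm.toLinearMap).toContinuousLinearMap

theorem entryL_apply (r c : Fin D) (X : A) : entryL e r c X = e.symm X r c := rfl

/-- The functional `X ↦ Tr(B X)`. -/
def traceMulL (B : Matrix (Fin D) (Fin D) ℂ) : A →L[ℂ] ℂ :=
  haveI : FiniteDimensional ℂ A := e.toLinearEquiv.finiteDimensional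
  ((Matrix.traceLinearMap (Fin D) ℂ ℂ).comp
    ((LinearMap.mulLeft ℂ B).comp e.symm.toLinearMap)).toContinuousLinearMap

theorem traceMulL_apply (B : Matrix (Fin D) (Fin D) ℂ) (X : A) :
    traceMulL e B X = Matrix.trace (B * e.symm X) := rfl

theorem dysonIntegrand_eq (B : Matrix (Fin D) (Fin D) ℂ) (Q T : ℝ → Matrix (Fin D) (Fin D) ℂ)
    (n : ℕ) (Φ Ψ : TestVector) (x : Fin n → ℝ) :
    dysonIntegrand B Q 0 0 T n Φ Ψ x =
      traceMulL e B (word (fun t => e (Q t)) (fun t => e (T t)) n (pairing Φ Ψ) x) := by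
  simp only [traceMulL_apply, dysonIntegrand, Matrix.trace, Matrix.diag_apply, Matrix.mul_apply,
    LinearMap.sum_apply, Module.End.mul_apply, Matrix.map_apply,
    Module.algebraMap_end_apply, LinearMap.smul_apply, generator_prod_vacuum e, smul_eq_mul]

/-! ### Matrix-valued functions -/

theorem map_matrix_eq_sum_smul (X : Matrix (Fin D) (Fin D) ℂ) :
    e X = ∑ a, ∑ b, X a b • e (Matrix.single a b (1 : ℂ)) := by
  conv_lhs => rw [Matrix.matrix_eq_sum_single X]
  simp only [map_sum, ← map_smul, Matrix.smul_single, smul_eq_mul, mul_one]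

theorem integrable_map_matrix {X : ℝ → Matrix (Fin D) (Fin D) ℂ} {μ : Measure ℝ}
    (h : ∀ a b, Integrable (fun t => X t a b) μ) : Integrable (fun t => e (X t)) μ := by
  rw [show (fun t => e (X t)) = fun t => ∑ a, ∑ b, X t a b • e (Matrix.single a b (1 : ℂ)) from
    funext fun t => map_matrix_eq_sum_smul e (X t)]
  exact integrable_finsetSum _ fun a _ => integrable_finsetSum _ fun b _ => (h a b).smul_const _

theorem aestronglyMeasurable_map_matrix {X : ℝ → Matrix (Fin D) (Fin D) ℂ} {μ : Measure ℝ}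
    (h : ∀ a b, AEStronglyMeasurable (fun t => X t a b) μ) :
    AEStronglyMeasurable (fun t => e (X t)) μ := by
  rw [show (fun t => e (X t)) = fun t => ∑ a, ∑ b, X t a b • e (Matrix.single a b (1 : ℂ)) from
    funext fun t => map_matrix_eq_sum_smul e (X t)]
  exact Finset.aestronglyMeasurable_fun_sum _ fun a _ =>
    Finset.aestronglyMeasurable_fun_sum _ fun b _ => (h a b).smul_const _

/-- Functions measurable on the box have strongly measurable modifications, vanishing outside. -/
theorem exists_modification {ℓ : ℝ≥0∞} {E : Type*} [NormedAddCommGroup E] {X : ℝ → E}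
    (hX : AEStronglyMeasurable X (volume.restrict (box ℓ))) :
    ∃ X' : ℝ → E, StronglyMeasurable X' ∧ (∀ t, t ∉ box ℓ → X' t = 0) ∧
      ∀ᵐ t, t ∈ box ℓ → X t = X' t := by
  have hb := measurableSet_box ℓ
  refine ⟨(box ℓ).indicator (hX.mk X), hX.stronglyMeasurable_mk.indicator hb,
    fun t ht => Set.indicator_of_notMem ht _, ?_⟩
  filter_upwards [(ae_restrict_iff' hb).1 hX.ae_eq_mk] with t ht htb
  rw [Set.indicator_of_mem htb, ht htb]

theorem integrableOn_modification {ℓ : ℝ≥0∞} {E : Type*} [NormedAddCommGroup E] {X X' : ℝ → E}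
    (h0 : ∀ t, t ∉ box ℓ → X' t = 0) (hae : ∀ᵐ t, t ∈ box ℓ → X t = X' t) {s : Set ℝ}
    (hs : MeasurableSet s) (hX : IntegrableOn X (s ∩ box ℓ)) : IntegrableOn X' s := by
  have hb := measurableSet_box ℓ
  have h1 : IntegrableOn X' (s ∩ box ℓ) := by
    refine hX.congr ((ae_restrict_iff' (hs.inter hb)).2 ?_)
    filter_upwards [hae] with t ht hts using ht hts.2
  exact h1.of_forall_sdiff_eq_zero hs fun t ht => h0 t fun hb => ht.2 ⟨ht.1, hb⟩

/-! ### Propagators and coefficients -/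

/-- The closed box and the open interval differ only by endpoints, which are null. -/
theorem simplex_ae_eq_chain (ℓ : ℝ≥0∞) (n : ℕ) :
    simplex n (box ℓ) =ᵐ[volume] chain n (-half ℓ) (half ℓ) := by
  have hne : ∀ e : EReal, ∀ᵐ t : ℝ, (t : EReal) ≠ e := by
    intro e
    have : Set.Subsingleton {t : ℝ | (t : EReal) = e} := fun s hs t ht =>
      EReal.coe_injective (hs.trans ht.symm)
    simpa [ae_iff] using this.measure_zero volume
  have h : ∀ᵐ t : ℝ, t ∈ box ℓ ↔ t ∈ between (-half ℓ) (half ℓ) := by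
    filter_upwards [hne (-half ℓ), hne (half ℓ)] with t h1 h2
    exact ⟨fun h => ⟨lt_of_le_of_ne h.1 h1.symm, lt_of_le_of_ne h.2 h2⟩,
      fun h => ⟨h.1.le, h.2.le⟩⟩
  filter_upwards [ae_forall_eval n h] with x hx
  refine propext ?_
  change (StrictMono x ∧ ∀ i, x i ∈ box ℓ) ↔ (StrictMono x ∧ ∀ i, x i ∈ between _ _)
  simp only [hx]

section Propagator

variable [CompleteSpace A] {ℓ : ℝ≥0∞} {Q : ℝ → Matrix (Fin D) (Fin D) ℂ} {Q' : ℝ → A}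

theorem propagator_eq_evol (h : Tensors Q' 0) (hQ : ∀ᵐ t, t ∈ box ℓ → e (Q t) = Q' t)
    {a b : EReal} (ha : -half ℓ ≤ a) (hb : b ≤ half ℓ) :
    propagator Q a b = e.symm (evol Q' a b) := by
  ext r c
  have hsum := (h.hasSum_dyson admissible_unitAmplitude a b).mapL (entryL e r c)
  refine Eq.trans ?_ hsum.tsum_eq
  refine tsum_congr fun n => ?_
  refine Eq.trans ?_ (ContinuousLinearMap.integral_comp_comm (entryL e r c)
    (h.integrable_word n admissible_unitAmplitude).integrableOn)
  refine setIntegral_congr_ae (measurableSet_chain n a b) ?_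
  filter_upwards [ae_forall_eval n hQ] with x hx hxm
  have : ∀ i, e (Q (x i)) = Q' (x i) := fun i =>
    hx i ⟨ha.trans (hxm.2 i).1.le, (hxm.2 i).2.le.trans hb⟩
  rw [word_unitAmplitude, entryL_apply, map_list_prod, List.map_ofFn]
  simp only [← this, Function.comp_def, AlgEquiv.symm_apply_apply]

omit [CompleteSpace A] in
theorem prod_evol_eq_linked (Q T : ℝ → A) (a b : EReal) {j : ℕ} (x : Fin j → ℝ) :
    (List.ofFn fun i : Fin j =>
      evol Q ((Fin.cons a (fun k => (x k : EReal)) : Fin (j + 1) → EReal) i.castSucc)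
        ((Fin.snoc (fun k => (x k : EReal)) b : Fin (j + 1) → EReal) i.castSucc) * T (x i)).prod *
      evol Q ((Fin.cons a (fun k => (x k : EReal)) : Fin (j + 1) → EReal) (Fin.last j))
        ((Fin.snoc (fun k => (x k : EReal)) b : Fin (j + 1) → EReal) (Fin.last j)) =
      linked Q T b j a x := by
  simp only [Fin.snoc_castSucc, Fin.snoc_last]
  induction j generalizing a with
  | zero => simp [linked]
  | succ j ih =>
    rw [List.ofFn_succ, List.prod_cons, linked, ← ih (x 0 : EReal) (Fin.tail x), ← mul_assoc]
    -- After the first factor is removed, the list of left endpoints is that of the tail, starting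
    -- from `x 0`.
    have hc : ∀ i : Fin (j + 1), (Fin.cons a (fun k => (x k : EReal)) : Fin (j + 2) → EReal) i.succ =
        (Fin.cons (x 0 : EReal) (fun k => ((Fin.tail x : Fin j → ℝ) k : EReal)) :
          Fin (j + 1) → EReal) i := by
      intro i
      rw [Fin.cons_succ]
      induction i using Fin.cases <;> simp [Fin.tail]
    simp only [← Fin.succ_last, ← Fin.succ_castSucc, hc]
    simp [Fin.tail]

/-- Propagators see Q only under integrals, so changing Q on a null set is harmless at every
configuration. T enters pointwise and is therefore left unmodified. -/
theorem coefficient_eq (h : Tensors Q' 0) (hQ : ∀ᵐ t, t ∈ box ℓ → e (Q t) = Q' t)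
    (B : Matrix (Fin D) (Fin D) ℂ) (T : ℝ → Matrix (Fin D) (Fin D) ℂ) {j : ℕ} {x : Fin j → ℝ}
    (hx : ∀ i, x i ∈ box ℓ) :
    coefficient ℓ B Q T x =
      traceMulL e B (linked Q' (fun t => e (T t)) (half ℓ) j (-half ℓ) x) := by
  have hneg : -half ℓ ≤ half ℓ := by
    have : (0 : EReal) ≤ half ℓ := EReal.coe_ennreal_nonneg _
    exact (EReal.neg_le_neg_iff.2 this).trans (by simpa using this)
  have hlink : ∀ i, link ℓ Q x i = e.symm
      (evol Q' ((Fin.cons (-half ℓ) (fun k => (x k : EReal)) : Fin (j + 1) → EReal) i)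
        ((Fin.snoc (fun k => (x k : EReal)) (half ℓ) : Fin (j + 1) → EReal) i)) := by
    intro i
    refine propagator_eq_evol e h hQ ?_ ?_
    · induction i using Fin.cases with
      | zero => simp
      | succ i => simpa using (hx i).1
    · induction i using Fin.lastCases with
      | last => simp
      | cast i => simpa using (hx i).2
  rw [traceMulL_apply, ← prod_evol_eq_linked, map_mul, map_list_prod, List.map_ofFn, ← mul_assoc,
    coefficient]
  simp only [hlink, Function.comp_def, map_mul, AlgEquiv.symm_apply_apply]

end Propagator

/-! ### Amplitudes of test vectors -/

theorem exists_pairing_eq_zero (Φ Ψ : TestVector) :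
    ∃ N, ∀ j, N ≤ j → pairing Φ Ψ j = 0 := by
  obtain ⟨N, hN⟩ := Ψ.2.2.2.2.bddAbove
  refine ⟨N + 1, fun j hj => ?_⟩
  have : Ψ.1 j = 0 := by
    by_contra h
    have := hN h
    omega
  funext x
  simp [pairing, this]

theorem exists_admissible_pairing (Φ Ψ : TestVector) :
    ∃ C, Admissible (pairing Φ Ψ) C := by
  obtain ⟨N, hN⟩ := exists_pairing_eq_zero Φ Ψ
  have h : ∀ j, ∃ C, ∀ x, ‖pairing Φ Ψ j x‖ ≤ C := fun j =>
    (hasCompactSupport_pairing Φ Ψ j).exists_bound_of_continuous (continuous_pairing Φ Ψ j)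
  choose C hC using h
  have hC0 : ∀ j, 0 ≤ C j := fun j => (norm_nonneg _).trans (hC j 0)
  refine ⟨∑ j ∈ Finset.range N, C j, fun j => (continuous_pairing Φ Ψ j).stronglyMeasurable,
    fun j x => ?_⟩
  by_cases hj : j < N
  · exact (hC j x).trans (Finset.single_le_sum (fun i _ => hC0 i) (Finset.mem_range.2 hj))
  · rw [hN j (not_lt.1 hj)]
    simpa using Finset.sum_nonneg fun i _ => hC0 i

/-- Only finitely many degrees are nonzero, each compactly supported, so a single radius serves all.
It determines the interval to which T is truncated. -/
theorem exists_pairing_support (Φ Ψ : TestVector) :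
    ∃ R : ℝ, ∀ j y, pairing Φ Ψ j y ≠ 0 → ∀ i, y i ∈ Set.Icc (-R) R := by
  obtain ⟨N, hN⟩ := exists_pairing_eq_zero Φ Ψ
  have h : ∀ j, ∃ R, ∀ y, pairing Φ Ψ j y ≠ 0 → ‖y‖ ≤ R := by
    intro j
    obtain ⟨R, hR⟩ := (hasCompactSupport_pairing Φ Ψ j).isCompact.isBounded.exists_norm_le
    exact ⟨R, fun y hy => hR y (subset_tsupport _ hy)⟩
  choose R hR using h
  refine ⟨∑ j ∈ Finset.range N, |R j|, fun j y hy i => ?_⟩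
  have hj : j < N := by
    by_contra hj
    exact hy (by rw [hN j (not_lt.1 hj)]; rfl)
  have h1 : |y i| ≤ ∑ j ∈ Finset.range N, |R j| := by
    calc |y i| = ‖y i‖ := (Real.norm_eq_abs _).symm
      _ ≤ ‖y‖ := norm_le_pi_norm y i
      _ ≤ R j := hR j y hy
      _ ≤ |R j| := le_abs_self _
      _ ≤ _ := Finset.single_le_sum (f := fun j => |R j|) (fun i _ => abs_nonneg _)
        (Finset.mem_range.2 hj)
  exact abs_le.1 h1

end

section
/-! ### The phase operator of a continuous matrix product state -/

theorem isClosed_box (ℓ : ℝ≥0∞) : IsClosed (box ℓ) :=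
  (isClosed_le continuous_const continuous_coe_real_ereal).inter
    (isClosed_le continuous_coe_real_ereal continuous_const)

variable {D : ℕ} {A : Type*} [NormedRing A] [NormedAlgebra ℂ A] [CompleteSpace A]
  (e : Matrix (Fin D) (Fin D) ℂ ≃ₐ[ℂ] A) {ℓ : ℝ≥0∞} (B : Matrix (Fin D) (Fin D) ℂ)
  {Q T : ℝ → Matrix (Fin D) (Fin D) ℂ} {Q' T' : ℝ → A}
include e

theorem coefficient_ae_eq (h : Tensors Q' 0) (hQ : ∀ᵐ t, t ∈ box ℓ → e (Q t) = Q' t)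
    (hT : ∀ᵐ t, t ∈ box ℓ → e (T t) = T' t) (j : ℕ) :
    ∀ᵐ x : Fin j → ℝ, x ∈ simplex j (box ℓ) → coefficient ℓ B Q T x =
      traceMulL e B (linked Q' T' (half ℓ) j (-half ℓ) x) := by
  filter_upwards [ae_forall_eval j hT] with x hx hxm
  rw [coefficient_eq e h hQ B T hxm.2]
  exact congrArg _ (linked_congr (fun i => hx i (hxm.2 i)) _ _)

theorem aestronglyMeasurable_coefficient (h : Tensors Q' 0)
    (hQ : ∀ᵐ t, t ∈ box ℓ → e (Q t) = Q' t) (hTm : StronglyMeasurable T')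
    (hT : ∀ᵐ t, t ∈ box ℓ → e (T t) = T' t) (j : ℕ) :
    AEStronglyMeasurable (fun x : Fin j → ℝ => coefficient ℓ B Q T x)
      (volume.restrict (simplex j (box ℓ))) := by
  have hm := (traceMulL e B).continuous.comp_stronglyMeasurable
    ((h.stronglyMeasurable_linked hTm (half ℓ) j).comp_measurable
      (measurable_prodMk_left (x := (-half ℓ))))
  refine ⟨_, hm, ?_⟩
  exact (ae_restrict_iff' (measurableSet_simplex (measurableSet_box ℓ))).2
    (coefficient_ae_eq e B h hQ hT j)

/-- The Dyson series of the matrix product operator is integrable order by order and sums to the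
series over particle numbers. -/
theorem hasSum_dysonIntegrand (h : Tensors Q' 0)
    (hQ : ∀ᵐ t, t ∈ box ℓ → e (Q t) = Q' t) (hTm : StronglyMeasurable T')
    (hT : ∀ᵐ t, t ∈ box ℓ → e (T t) = T' t)
    (hTi : ∀ R : ℝ, IntegrableOn T' (Set.Icc (-R) R)) (Φ Ψ : TestVector) {s : ℂ}
    (hs : HasSum (fun j => ∫ x in simplex j (box ℓ), coefficient ℓ B Q T x * pairing Φ Ψ j x) s) :
    (∀ n, IntegrableOn (dysonIntegrand B Q 0 0 T n Φ Ψ) (simplex n (box ℓ))) ∧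
      HasSum (fun n => ∫ x in simplex n (box ℓ), dysonIntegrand B Q 0 0 T n Φ Ψ x) s := by
  obtain ⟨N, hN⟩ := exists_pairing_eq_zero Φ Ψ
  obtain ⟨C, hC⟩ := exists_admissible_pairing Φ Ψ
  obtain ⟨R, hR⟩ := exists_pairing_support Φ Ψ
  set K : Set ℝ := Set.Icc (-R) R
  have hK : MeasurableSet K := measurableSet_Icc
  have hS : ∀ n, MeasurableSet (simplex n (box ℓ)) := fun n =>
    measurableSet_simplex (measurableSet_box ℓ)
  -- Local integrability becomes integrability after truncation, so the whole Dyson theory applies.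
  have hten : Tensors Q' (K.indicator T') :=
    ⟨h.measQ, hTm.indicator hK, h.intQ, (integrable_indicator_iff hK).2 (hTi R)⟩
  have hword : ∀ n, ∀ᵐ x : Fin n → ℝ, x ∈ simplex n (box ℓ) →
      dysonIntegrand B Q 0 0 T n Φ Ψ x =
        traceMulL e B (word Q' (K.indicator T') n (pairing Φ Ψ) x) := by
    intro n
    filter_upwards [ae_forall_eval n hQ, ae_forall_eval n hT] with x hxQ hxT hxm
    rw [dysonIntegrand_eq e]
    refine congrArg _ (word_congr hR (fun i => hxQ i (hxm.2 i)) fun i hi => ?_)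
    rw [Set.indicator_of_mem hi, hxT i (hxm.2 i)]
  have hwi : ∀ n, Integrable fun x : Fin n → ℝ =>
      traceMulL e B (word Q' (K.indicator T') n (pairing Φ Ψ) x) := fun n =>
    (traceMulL e B).integrable_comp (hten.integrable_word n hC)
  refine ⟨fun n => (hwi n).integrableOn.congr
    (((ae_restrict_iff' (hS n)).2 (hword n)).mono fun x hx => hx.symm), ?_⟩
  have h1 : ∀ n, ∫ x in simplex n (box ℓ), dysonIntegrand B Q 0 0 T n Φ Ψ x =
      traceMulL e B (∫ x in chain n (-half ℓ) (half ℓ),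
        word Q' (K.indicator T') n (pairing Φ Ψ) x) := by
    intro n
    rw [setIntegral_congr_ae (hS n) (hword n), setIntegral_congr_set (simplex_ae_eq_chain ℓ n)]
    exact ContinuousLinearMap.integral_comp_comm _ (hten.integrable_word n hC).integrableOn
  have h2 : ∀ j, ∫ x in simplex j (box ℓ), coefficient ℓ B Q T x * pairing Φ Ψ j x =
      traceMulL e B (∫ x in chain j (-half ℓ) (half ℓ),
        pairing Φ Ψ j x • linked Q' (K.indicator T') (half ℓ) j (-half ℓ) x) := by
    intro j
    rw [← ContinuousLinearMap.integral_comp_comm _ (hten.integrable_linked j (hC.measurable j)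
      (hC.norm_le j) _ _).integrableOn, ← setIntegral_congr_set (simplex_ae_eq_chain ℓ j)]
    refine setIntegral_congr_ae (hS j) ?_
    filter_upwards [coefficient_ae_eq e B h hQ hT j] with x hx hxm
    rw [hx hxm, map_smul, smul_eq_mul, mul_comm]
    by_cases h0 : pairing Φ Ψ j x = 0
    · simp [h0]
    · have : ∀ i, T' (x i) = K.indicator T' (x i) := fun i =>
        (Set.indicator_of_mem (hR j x h0 i) _).symm
      rw [linked_congr this]
  -- The series over particle numbers is a finite sum here, and `dyson_eq_sum` identifies it with
  -- the trace of the Dyson series.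
  have hs' : s = traceMulL e B (dyson Q' (K.indicator T') (pairing Φ Ψ) (-half ℓ) (half ℓ)) := by
    rw [hten.dyson_eq_sum N hC hN, map_sum]
    simp only [← h2]
    refine hs.unique (hasSum_sum_of_ne_finset_zero fun j hj => ?_)
    rw [hN j (by simpa using hj)]
    simp
  simp only [h1]
  rw [hs']
  exact (hten.hasSum_dyson hC _ _).mapL (traceMulL e B)

/-- The operator of multiplication by the coefficients of a phase matrix product state. -/
theorem exists_phaseOperator
    (hQ : ∀ a b, IntegrableOn (fun x => Q x a b) (box ℓ))
    (hT : ∀ a b, LocallyIntegrableOn (fun x => T x a b) (box ℓ)) (hphase : IsPhaseCMPS ℓ B Q T) :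
    ∃ U : Fock ℓ →L[ℂ] Fock ℓ, IsFockSeries ℓ B Q T U ∧
      (∀ U' : Fock ℓ →L[ℂ] Fock ℓ, IsFockSeries ℓ B Q T U' → U' = U) ∧
      (∀ (Φ : Fock ℓ) (j : ℕ), ∀ᵐ x ∂volume.restrict (simplex j (box ℓ)),
        wavefunction (U Φ) j x = coefficient ℓ B Q T x * wavefunction Φ j x) ∧
      U ∈ unitary (Fock ℓ →L[ℂ] Fock ℓ) ∧ IsCMPO ℓ B Q 0 0 T U := by
  have hb := measurableSet_box ℓ
  have hQi : IntegrableOn (fun t => e (Q t)) (box ℓ) := integrable_map_matrix e hQ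
  -- Vanishing outside the box turns integrability on the box into integrability on the line, as
  -- `Tensors` requires.
  obtain ⟨Q', hQm, hQ0, hQae⟩ := exists_modification hQi.aestronglyMeasurable
  obtain ⟨T', hTm, hT0, hTae⟩ := exists_modification
    (aestronglyMeasurable_map_matrix e fun a b => (hT a b).aestronglyMeasurable)
  have hten : Tensors Q' 0 := by
    refine ⟨hQm, stronglyMeasurable_zero, ?_, integrable_zero _ _ _⟩
    rw [← integrableOn_univ]
    exact integrableOn_modification hQ0 hQae MeasurableSet.univ (by simpa using hQi)
  have hTi : ∀ R : ℝ, IntegrableOn T' (Set.Icc (-R) R) := by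
    intro R
    refine integrableOn_modification hT0 hTae measurableSet_Icc ?_
    exact integrable_map_matrix e fun a b => (hT a b).integrableOn_compact_subset
      Set.inter_subset_right (isCompact_Icc.inter_right (isClosed_box ℓ))
  obtain ⟨θ, hθ⟩ := hphase
  have hnorm : ∀ j, ∀ x ∈ simplex j (box ℓ), ‖coefficient ℓ B Q T x‖ = 1 := by
    intro j x hx
    rw [hθ j x hx, mul_comm, Complex.norm_exp_ofReal_mul_I]
  have hcm := aestronglyMeasurable_coefficient e B hten hQae hTm hTae
  -- The hypothesis controls the coefficients only on ordered configurations and says nothing about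
  -- measurability of θ; measurability comes from the Dyson series.
  choose u hu huae using fun j => exists_isPhase (hcm j) (hnorm j)
  have hint : ∀ Φ Ψ j, ∫ x in simplex j (box ℓ), coefficient ℓ B Q T x * pairing Φ Ψ j x =
      ∫ x in simplex j (box ℓ), u j x * pairing Φ Ψ j x := by
    intro Φ Ψ j
    refine integral_congr_ae ?_
    filter_upwards [huae j] with x hx
    rw [hx]
  have hsum : ∀ Φ Ψ : TestVector,
      HasSum (fun j => ∫ x in simplex j (box ℓ), coefficient ℓ B Q T x * pairing Φ Ψ j x)
        (inner ℂ (toFock ℓ Φ) (mulFockL hu (toFock ℓ Ψ))) := by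
    intro Φ Ψ
    simp only [hint]
    exact inner_mulFockL hu Φ Ψ
  have hF : ∀ (j : ℕ) (Φ Ψ : TestVector), fockIntegrand ℓ B Q T j Φ Ψ =
      fun x => coefficient ℓ B Q T x * pairing Φ Ψ j x := by
    intro j Φ Ψ
    funext x
    rw [fockIntegrand, adMap_prod_vacuum]
  refine ⟨mulFockL hu, fun Φ Ψ => ⟨fun j => ?_, ?_⟩, fun U' hU' => ?_, fun Φ j => ?_,
    mulFockL_mem_unitary hu, fun Φ Ψ => ?_⟩
  · rw [hF]
    refine (((continuous_pairing Φ Ψ j).integrable_of_hasCompactSupport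
      (hasCompactSupport_pairing Φ Ψ j)).integrableOn).bdd_mul (c := 1) (hcm j) ?_
    exact (ae_restrict_iff' (measurableSet_simplex hb)).2
      (Filter.Eventually.of_forall fun x hx => (hnorm j x hx).le)
  · simp only [hF]
    exact hsum Φ Ψ
  · refine ext_inner_toFock fun Φ Ψ => ?_
    have h := (hU' Φ Ψ).2
    simp only [hF] at h
    exact h.unique (hsum Φ Ψ)
  · have h := wavefunction_mulFockL hu Φ j
    rw [boxMeasure_eq_restrict] at h
    have hsub : simplex j (box ℓ) ⊆ Set.univ.pi fun _ => box ℓ := fun x hx i _ => hx.2 i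
    have h' := ae_restrict_of_ae_restrict_of_subset hsub h
    filter_upwards [h', huae j] with x h1 h2
    rw [h1, h2]
  · exact hasSum_dysonIntegrand e B hten hQae hTm hTae hTi Φ Ψ (hsum Φ Ψ)

end

end CMPO

end

theorem mainTheorem9 {D : ℕ} (ℓ : ENNReal) (hℓ : 0 < ℓ)
    (B : Matrix (Fin D) (Fin D) ℂ) (Q T : ℝ → Matrix (Fin D) (Fin D) ℂ)
    (hQ : ∀ a b, MeasureTheory.IntegrableOn (fun x => Q x a b) (CMPO.box ℓ))
    (hT : ∀ a b, MeasureTheory.LocallyIntegrableOn (fun x => T x a b) (CMPO.box ℓ))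
    (hphase : CMPO.IsPhaseCMPS ℓ B Q T) :
    ∃ U : CMPO.Fock ℓ →L[ℂ] CMPO.Fock ℓ,
      -- `U` is the operator defined by the sum over particle numbers, and the only one
      CMPO.IsFockSeries ℓ B Q T U ∧
      (∀ U' : CMPO.Fock ℓ →L[ℂ] CMPO.Fock ℓ, CMPO.IsFockSeries ℓ B Q T U' → U' = U) ∧
      -- it is diagonal: it multiplies wavefunctions by the matrix-product coefficients
      (∀ (Φ : CMPO.Fock ℓ) (j : ℕ),
        ∀ᵐ x ∂MeasureTheory.volume.restrict (CMPO.simplex j (CMPO.box ℓ)),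
          CMPO.wavefunction (U Φ) j x = CMPO.coefficient ℓ B Q T x * CMPO.wavefunction Φ j x) ∧
      -- it is unitary
      U ∈ unitary (CMPO.Fock ℓ →L[ℂ] CMPO.Fock ℓ) ∧
      -- it is the cMPO with tensors `B, Q, T` and `L = R = 0`
      CMPO.IsCMPO ℓ B Q 0 0 T U := by
  -- Any complete submultiplicative norm on the matrices would do; the operator norm on Euclidean
  -- space supplies one.
  exact CMPO.exists_phaseOperator (Matrix.toEuclideanCLM (n := Fin D) (𝕜 := ℂ)).toAlgEquiv B
    hQ hT hphase
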